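/- **Setting.** Let $K\subset\mathbb R^2$ be a bounded convex open set (a grid cell) and $K_f\subset K$ a nonempty open subset (the fracture part). Put $K_m=K\setminus\overline{K_f}$ (the matrix part), $\Gamma_I=\partial K_f\cap K$ (the interface), $\Gamma_m=\partial K_m\cap\partial K$, $\Gamma_f=\partial K_f\cap\partial K$. Assume that $K_m\ne\emptyset$, that $\Gamma_I$ has zero area, and that $\overline{\Gamma_I}\cap\partial K$ is finite (possibly empty). Let $c_m,c_f,\Phi_m,\Phi_f,\mu,\bar q_f>0$ be constants, and let $\mathbf K$ be a measurable, symmetric, bounded and uniformly positive definite permeability tensor on $K$, equal to $\mathbf K_m$ in $K_m$ and to $\mathbf K_f$ in $K_f$. Write $|\cdot|$ for area and $u=-\frac{\mathbf K}{\mu}\nabla p$ for the Darcy flux. The slightly compressible matrix-fracture flow problem for a pressure $p$ (with $p_m=p|_{K_m}$, $p_f=p|_{K_f}$) is $$c_m\Phi_m\partial_t p_m-\nabla\cdot\Big(\frac{\mathbf K_m}{\mu}\nabla p_m\Big)=0\ \text{ in }K_m,\qquad c_f\Phi_f\partial_t p_f-\nabla\cdot\Big(\frac{\mathbf K_f}{\mu}\nabla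 p_f\Big)=\bar q_f\ \text{ in }K_f,$$ with no flow ($u\cdot n=0$) through $\Gamma_m$ and $\Gamma_f$, and with continuity of pressure and of normal flux across $\Gamma_I$. *Solution for $t>T$* means: for every $t>T$ the pressure $p(t)$ is in $H^1(K_m)$ and $H^1(K_f)$, it has a time derivative $\partial_tp(t)$ in $L^2(K_m)$ and $L^2(K_f)$ (limit of difference quotients in $L^2$), the two equations hold with weak derivatives, and the boundary and interface conditions hold for the weak traces. Here the normal trace of $u$ on $\partial D$ is the functional $\varphi\mapsto\int_D(u\cdot\nabla\varphi+\varphi\,\nabla\cdot u)$ and the trace of $p$ is $\varphi\mapsto\int_D(p\nabla\varphi+\varphi\nabla p)$, for $D=K_m,K_f$; conditions on $\Gamma_m,\Gamma_f$ are tested with smooth $\varphi$ vanishing near $\overline{\Gamma_I}$, those on $\Gamma_I$ with $\varphi\in C_c^\infty(K)$. For $q_s\in\mathbb R$, the *stationary Neumann problem with parameter $q_s$* is $$-\nabla\cdot\Big(\frac{\mathbf K}{\mu}\nabla w\Big)=\begin{cases}q_s&\text{in }K_f\\-\frac{|K_f|}{|K_m|}q_s&\text{in }K_m\end{cases},\qquad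 -\Big(\frac{\mathbf K}{\mu}\nabla w\Big)\cdot n=0\ \text{ on }\partial K,\qquad \frac1{|K|}\int_K w=0,$$ with $w\in H^1(K)$, weak derivatives, and the weak normal trace on $\partial K$ tested with all smooth $\varphi$. The *balance* for $a_m,a_f\in\mathbb R$ is $$|K_m|c_m\Phi_m a_m+|K_f|c_f\Phi_f a_f=|K_f|\,\bar q_f .\tag{B}$$ **Theorem.** 1. Every solution for $t>T$ satisfies, at every $t>T$, $\displaystyle\int_{K_m}c_m\Phi_m\partial_tp_m+\int_{K_f}c_f\Phi_f\partial_tp_f=\int_{K_f}\bar q_f$. 2. For each $q_s$, the stationary problem has at most one solution, up to equality almost everywhere. 3. (Exact pseudo steady state.) Let $T,a_m,a_f\in\mathbb R$. The function $p$ is a solution for $t>T$ with $\partial_tp_m=a_m$ and $\partial_tp_f=a_f$ for all $t>T$ if and only if: (B) holds; $a_m=a_f$; for every $t>T$ the function $p(t)-\frac1{|K|}\int_Kp(t)$ solves the stationary problem with parameter $\bar q_{f,s}=\bar q_f-c_f\Phi_fa_f$; and there is a constant $C$ with $\frac1{|K|}\int_Kp(t)=a_ft+C$ for all $t>T$. 4.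 (Zero initial data.) Let $p$ be a solution for $t>0$ with zero initial data, $p(0)=0$ and $p(t)\to0$ in $L^2(K)$ as $t\to0^+$, which approaches a pseudo steady state: $\partial_tp_m(t)\to a_m$ in $L^2(K_m)$ and $\partial_tp_f(t)\to a_f$ in $L^2(K_f)$ as $t\to\infty$, with $a_m,a_f\in\mathbb R$. Then (B) holds, $a_m=a_f$, and $p(t)\in H^1(K)$ for $t>0$; moreover, as $t\to\infty$, $p(t)-\frac1{|K|}\int_Kp(t)$ converges in $H^1(K)$ to a solution of the stationary problem with parameter $\bar q_{f,s}=\bar q_f-c_f\Phi_fa_f$. -/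

import Mathlib

open MeasureTheory Set Filter Topology
open scoped ENNReal ContDiff Gradient

noncomputable section

/-- The plane with its Euclidean norm. -/
abbrev Plane : Type := EuclideanSpace ℝ (Fin 2)

/-- Test functions of an open set `D`: smooth functions whose support is a compact subset
of `D`. -/
def IsTestFunction (D : Set Plane) (φ : Plane → ℝ) : Prop :=
  ContDiff ℝ ∞ φ ∧ HasCompactSupport φ ∧ tsupport φ ⊆ D

/-- `u` belongs to `H¹(D)` and `G` is its weak gradient on `D`. -/
structure HasH1Gradient (D : Set Plane) (u : Plane → ℝ) (G : Plane → Plane) : Prop where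
  memLp : MemLp u 2 (volume.restrict D)
  memLp_gradient : MemLp G 2 (volume.restrict D)
  weak_gradient : ∀ φ, IsTestFunction D φ →
    ∫ x in D, u x • ∇ φ x = -∫ x in D, φ x • G x

/-- The vector field `w ∈ L²(D)` has the weak divergence `g ∈ L²(D)` on `D`. -/
structure HasWeakDivergence (D : Set Plane) (w : Plane → Plane) (g : Plane → ℝ) : Prop where
  memLp : MemLp w 2 (volume.restrict D)
  memLp_div : MemLp g 2 (volume.restrict D)
  weak_div : ∀ φ, IsTestFunction D φ →
    ∫ x in D, inner ℝ (w x) (∇ φ x) = -∫ x in D, g x * φ x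

/-- The pairing of the outward normal trace on `∂D` of a field `w` with divergence `g` on `D`
against a smooth function `φ`. Where the fields are regular up to the boundary, Green's formula
gives that this is the boundary integral of `(w · n) φ` over `∂D`. -/
def normalTrace (D : Set Plane) (w : Plane → Plane) (g φ : Plane → ℝ) : ℝ :=
  ∫ x in D, (inner ℝ (w x) (∇ φ x) + g x * φ x)

/-- The pairing of the boundary trace on `∂D` of a function `u ∈ H¹(D)` with weak gradient `G`
against a smooth function `φ`. Where the functions are regular up to the boundary, Green's formula
gives that this is the boundary integral of `u φ n` over `∂D`, with `n` the outward normal. -/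
def pressureTrace (D : Set Plane) (u : Plane → ℝ) (G : Plane → Plane) (φ : Plane → ℝ) : Plane :=
  ∫ x in D, (u x • ∇ φ x + φ x • G x)

/-- `s` is the time derivative of `p` at time `t`, in `L²(D)`. -/
def HasL2TimeDeriv (D : Set Plane) (p : ℝ → Plane → ℝ) (s : Plane → ℝ) (t : ℝ) : Prop :=
  MemLp s 2 (volume.restrict D) ∧
  Tendsto (fun h : ℝ =>
      eLpNorm (fun x => h⁻¹ * (p (t + h) x - p t x) - s x) 2 (volume.restrict D))
    (𝓝[≠] 0) (𝓝 0)

/-- A grid cell cut by a fracture, with the physical data of the matrix-fracture local problem.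
The interface `Γ_I` is the part of the boundary of the fracture region inside the cell. It has
zero area, and it reaches the boundary of the cell at finitely many points at most (none if the
fracture is immersed in the cell, the corners of the fracture region where the fracture leaves
the cell). -/
structure MFProblem where
  /-- the cell -/
  K : Set Plane
  /-- the fracture part of the cell -/
  Kf : Set Plane
  isOpen_K : IsOpen K
  convex_K : Convex ℝ K
  isBounded_K : Bornology.IsBounded K
  isOpen_Kf : IsOpen Kf
  Kf_subset : Kf ⊆ K
  Kf_nonempty : Kf.Nonempty
  Km_nonempty : (K \ closure Kf).Nonempty
  interface_null : volume (frontier Kf ∩ K) = 0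
  interface_ends : (closure (frontier Kf ∩ K) ∩ frontier K).Finite
  /-- the permeability tensor, with possibly different values in matrix and fracture -/
  perm : Plane → Plane →L[ℝ] Plane
  perm_measurable : ∀ v, Measurable fun x => perm x v
  perm_symm : ∀ x ∈ K, ∀ v w, inner ℝ (perm x v) w = inner ℝ v (perm x w)
  perm_elliptic : ∃ α : ℝ, 0 < α ∧ ∀ x ∈ K, ∀ v, α * ‖v‖ ^ 2 ≤ inner ℝ (perm x v) v
  perm_bounded : ∃ β : ℝ, ∀ x ∈ K, ‖perm x‖ ≤ β
  /-- the dynamic viscosity -/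
  visc : ℝ
  visc_pos : 0 < visc
  /-- the compressibilities in matrix and fracture -/
  cm : ℝ
  cf : ℝ
  cm_pos : 0 < cm
  cf_pos : 0 < cf
  /-- the porosities of matrix and fracture -/
  Φm : ℝ
  Φf : ℝ
  Φm_pos : 0 < Φm
  Φf_pos : 0 < Φf
  /-- the source in the fracture -/
  q : ℝ
  q_pos : 0 < q

namespace MFProblem

variable (P : MFProblem)

/-- The matrix part of the cell. -/
def Km : Set Plane := P.K \ closure P.Kf

/-- The matrix-fracture interface. -/
def interface : Set Plane := frontier P.Kf ∩ P.K

/-- The Darcy flux `-(𝐊/μ) G` of a pressure with gradient `G`. -/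
def darcyFlux (G : Plane → Plane) : Plane → Plane :=
  fun x => -(P.visc⁻¹ • P.perm x (G x))

/-- The flow problem at one instant: `p` is the pressure and `s` its time derivative. The
equations hold separately in `K_m` and in `K_f`, there is no flow through `Γ_m` and `Γ_f`, and
pressure and normal flux are continuous across the interface `Γ_I`. Conditions on `Γ_m` and `Γ_f`
are tested by functions that vanish near the interface, those on `Γ_I` by functions that vanish
near the boundary of the cell. -/
def HoldsAt (p s : Plane → ℝ) : Prop :=
  ∃ (G : Plane → Plane) (g : Plane → ℝ),
    HasH1Gradient P.Km p G ∧ HasH1Gradient P.Kf p G ∧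
    -- `c_m Φ_m ∂p_m/∂t - ∇ · ((𝐊_m/μ) ∇p_m) = 0` in `K_m`
    HasWeakDivergence P.Km (P.darcyFlux G) g ∧
    (∀ᵐ x ∂volume.restrict P.Km, P.cm * P.Φm * s x + g x = 0) ∧
    -- `c_f Φ_f ∂p_f/∂t - ∇ · ((𝐊_f/μ) ∇p_f) = q` in `K_f`
    HasWeakDivergence P.Kf (P.darcyFlux G) g ∧
    (∀ᵐ x ∂volume.restrict P.Kf, P.cf * P.Φf * s x + g x = P.q) ∧
    -- no flow through `Γ_m` and `Γ_f`
    (∀ φ : Plane → ℝ, ContDiff ℝ ∞ φ → Disjoint (tsupport φ) (closure P.interface) →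
      normalTrace P.Km (P.darcyFlux G) g φ = 0 ∧ normalTrace P.Kf (P.darcyFlux G) g φ = 0) ∧
    -- `p_m = p_f` on `Γ_I`
    (∀ φ, IsTestFunction P.K φ → pressureTrace P.Km p G φ + pressureTrace P.Kf p G φ = 0) ∧
    -- equal normal fluxes on `Γ_I` (the outward normals of `K_m` and `K_f` are opposite there)
    (∀ φ, IsTestFunction P.K φ →
      normalTrace P.Km (P.darcyFlux G) g φ + normalTrace P.Kf (P.darcyFlux G) g φ = 0)

/-- `p`, with time derivative `s`, solves the flow problem, without initial condition, at all times
`t > T`. -/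
def IsSolutionAfter (T : ℝ) (p s : ℝ → Plane → ℝ) : Prop :=
  ∀ t, T < t →
    HasL2TimeDeriv P.Km p (s t) t ∧ HasL2TimeDeriv P.Kf p (s t) t ∧ P.HoldsAt (p t) (s t)

/-- `p`, with time derivative `s`, solves the initial-boundary value problem with zero initial
data. -/
def IsInitialValueSolution (p s : ℝ → Plane → ℝ) : Prop :=
  P.IsSolutionAfter 0 p s ∧
  (∀ᵐ x ∂volume.restrict P.K, p 0 x = 0) ∧
  Tendsto (fun t => eLpNorm (p t) 2 (volume.restrict P.K)) (𝓝[>] 0) (𝓝 0)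

/-- `p` solves the flow problem for `t > T` and is at pseudo steady state there:
`∂p_m/∂t = a_m` and `∂p_f/∂t = a_f`. -/
def IsPseudoSteadyAfter (T : ℝ) (p : ℝ → Plane → ℝ) (am af : ℝ) : Prop :=
  ∃ s : ℝ → Plane → ℝ, P.IsSolutionAfter T p s ∧
    ∀ t, T < t → (∀ᵐ x ∂volume.restrict P.Km, s t x = am) ∧
      (∀ᵐ x ∂volume.restrict P.Kf, s t x = af)

/-- The time derivatives `∂p_m/∂t` and `∂p_f/∂t` tend to the constants `a_m` and `a_f` in `L²` as
time tends to infinity. -/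
def TendsToPseudoSteady (s : ℝ → Plane → ℝ) (am af : ℝ) : Prop :=
  Tendsto (fun t => eLpNorm (fun x => s t x - am) 2 (volume.restrict P.Km)) atTop (𝓝 0) ∧
  Tendsto (fun t => eLpNorm (fun x => s t x - af) 2 (volume.restrict P.Kf)) atTop (𝓝 0)

/-- The balance `|K_m| c_m Φ_m a_m + |K_f| c_f Φ_f a_f = |K_f| q`. -/
def Balance (am af : ℝ) : Prop :=
  volume.real P.Km * P.cm * P.Φm * am + volume.real P.Kf * P.cf * P.Φf * af
    = volume.real P.Kf * P.q

/-- The source of the stationary problem: `qs` in `K_f` and `-(|K_f|/|K_m|) qs` in `K_m`. -/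
def stationarySource (qs : ℝ) : Plane → ℝ := fun x =>
  P.Kf.indicator (fun _ => qs) x
    + P.Km.indicator (fun _ => -(volume.real P.Kf / volume.real P.Km) * qs) x

/-- `w` solves the stationary pure Neumann problem with source parameter `qs`, on the whole cell,
and has zero mean. -/
def IsStationarySolution (qs : ℝ) (w : Plane → ℝ) : Prop :=
  (∃ G : Plane → Plane,
    HasH1Gradient P.K w G ∧
    HasWeakDivergence P.K (P.darcyFlux G) (P.stationarySource qs) ∧
    ∀ φ : Plane → ℝ, ContDiff ℝ ∞ φ →
      normalTrace P.K (P.darcyFlux G) (P.stationarySource qs) φ = 0) ∧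
  ⨍ x in P.K, w x = 0

/-- The deviation of a pressure from its mean over the cell. -/
def fluctuation (p : Plane → ℝ) : Plane → ℝ := fun x => p x - ⨍ y in P.K, p y

end MFProblem

end

/-!
A smooth function vanishing near the interface endpoints splits into one vanishing near `∂K` and one
vanishing near `Γ_I`. Hence, on such test functions, the conditions on `Γ_m`, `Γ_f` and `Γ_I` glue
to one pure Neumann problem on the whole cell. The endpoints are finitely many and points of the
plane have zero `H¹`-capacity (cutoffs around a point have Dirichlet energy bounded uniformly in the
radius), so every smooth test function is reached.
On the convex cell, Poincaré's inequality and density of smooth functions make the map from source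
to zero-mean solution Lipschitz into `H¹`; this gives uniqueness, and convergence of the solutions
whenever the sources converge in `L²`. Testing with `1` gives the mass balance. Finally, the
difference of the pressure means over `K_m` and `K_f` is unaffected by subtracting the mean over
`K`, hence converges, while its derivative tends to `a_m - a_f`, which is therefore zero.
-/

section BilinearPairing

variable {α ι E F H : Type*} [MeasurableSpace α] {μ : Measure α}
  [NormedAddCommGroup E] [NormedSpace ℝ E] [NormedAddCommGroup F] [NormedSpace ℝ F]
  [NormedAddCommGroup H] [NormedSpace ℝ H] {p q : ℝ≥0∞} [p.HolderConjugate q]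

theorem eLpNorm_one_bilin_le (B : E →L[ℝ] F →L[ℝ] H) {f : α → E} {h : α → F}
    (hf : AEStronglyMeasurable f μ) (hh : AEStronglyMeasurable h μ) :
    eLpNorm (fun x => B (f x) (h x)) 1 μ ≤ ‖B‖ₑ * eLpNorm f p μ * eLpNorm h q μ :=
  eLpNorm_le_eLpNorm_mul_eLpNorm_of_nnnorm hf hh (fun a b => B a b) ‖B‖₊
    (.of_forall fun x => B.le_opNorm₂ (f x) (h x))

theorem integrable_bilin (B : E →L[ℝ] F →L[ℝ] H) {f : α → E} {h : α → F}
    (hf : MemLp f p μ) (hh : MemLp h q μ) : Integrable (fun x => B (f x) (h x)) μ :=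
  memLp_one_iff_integrable.1
    (MemLp.of_bilin (fun a b => B a b) ‖B‖₊ hf hh (B.aestronglyMeasurable_comp₂ hf.1 hh.1)
      (.of_forall fun x => B.le_opNorm₂ (f x) (h x)))

theorem enorm_integral_bilin_le (B : E →L[ℝ] F →L[ℝ] H) {f : α → E} {h : α → F}
    (hf : AEStronglyMeasurable f μ) (hh : AEStronglyMeasurable h μ) :
    ‖∫ x, B (f x) (h x) ∂μ‖ₑ ≤ ‖B‖ₑ * eLpNorm f p μ * eLpNorm h q μ :=
  calc ‖∫ x, B (f x) (h x) ∂μ‖ₑ ≤ ∫⁻ x, ‖B (f x) (h x)‖ₑ ∂μ := enorm_integral_le_lintegral_enorm _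
    _ = eLpNorm (fun x => B (f x) (h x)) 1 μ := eLpNorm_one_eq_lintegral_enorm.symm
    _ ≤ ‖B‖ₑ * eLpNorm f p μ * eLpNorm h q μ := eLpNorm_one_bilin_le B hf hh

theorem tendsto_integral_bilin (B : E →L[ℝ] F →L[ℝ] H) {l : Filter ι} {f : ι → α → E}
    {f₀ : α → E} {h : α → F} (hf : ∀ᶠ i in l, MemLp (f i) p μ) (hf₀ : MemLp f₀ p μ)
    (hh : MemLp h q μ) (hlim : Tendsto (fun i => eLpNorm (fun x => f i x - f₀ x) p μ) l (𝓝 0)) :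
    Tendsto (fun i => ∫ x, B (f i x) (h x) ∂μ) l (𝓝 (∫ x, B (f₀ x) (h x) ∂μ)) := by
  refine tendsto_integral_of_L1' _ (integrable_bilin B hf₀ hh).1
    (hf.mono fun i hi => integrable_bilin B hi hh) ?_
  have hbound : Tendsto (fun i => ‖B‖ₑ * eLpNorm (fun x => f i x - f₀ x) p μ * eLpNorm h q μ)
      l (𝓝 0) := by
    simpa using ENNReal.Tendsto.mul_const (ENNReal.Tendsto.const_mul (a := ‖B‖ₑ) hlim (by simp))
      (b := eLpNorm h q μ) (Or.inr hh.2.ne)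
  refine tendsto_of_tendsto_of_tendsto_of_le_of_le' tendsto_const_nhds hbound
    (.of_forall fun _ => zero_le) (hf.mono fun i hi => ?_)
  simpa only [Pi.sub_def, map_sub, sub_apply] using eLpNorm_one_bilin_le B (hi.1.sub hf₀.1) hh.1

theorem tendsto_integral_of_tendsto_eLpNorm [IsFiniteMeasure μ] {p : ℝ≥0∞} (hp : 1 ≤ p)
    {l : Filter ι} {f : ι → α → E} {f₀ : α → E} (hf : ∀ᶠ i in l, MemLp (f i) p μ)
    (hf₀ : MemLp f₀ p μ)
    (hlim : Tendsto (fun i => eLpNorm (fun x => f i x - f₀ x) p μ) l (𝓝 0)) :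
    Tendsto (fun i => ∫ x, f i x ∂μ) l (𝓝 (∫ x, f₀ x ∂μ)) := by
  have : Fact (1 ≤ p) := ⟨hp⟩
  simpa using tendsto_integral_bilin (q := p.conjExponent)
    (ContinuousLinearMap.lsmul ℝ ℝ : ℝ →L[ℝ] E →L[ℝ] E).flip
    hf hf₀ (memLp_const (1 : ℝ)) hlim

theorem tendsto_average_of_tendsto_eLpNorm [IsFiniteMeasure μ] {p : ℝ≥0∞} (hp : 1 ≤ p)
    {l : Filter ι} {f : ι → α → E} {f₀ : α → E} (hf : ∀ᶠ i in l, MemLp (f i) p μ)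
    (hf₀ : MemLp f₀ p μ)
    (hlim : Tendsto (fun i => eLpNorm (fun x => f i x - f₀ x) p μ) l (𝓝 0)) :
    Tendsto (fun i => ⨍ x, f i x ∂μ) l (𝓝 (⨍ x, f₀ x ∂μ)) := by
  simpa only [average_eq] using
    (tendsto_integral_of_tendsto_eLpNorm hp hf hf₀ hlim).const_smul (μ.real univ)⁻¹

end BilinearPairing

section LpLimits

variable {α E ι : Type*} [MeasurableSpace α] {μ : Measure α} [NormedAddCommGroup E] {p : ℝ≥0∞}
  {l : Filter ι} {f : ι → α → E}

theorem tendsto_eLpNorm_sub_prod (hp : 1 ≤ p) {g : α → E} (hf : ∀ᶠ i in l, MemLp (f i) p μ)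
    (hg : MemLp g p μ) (hlim : Tendsto (fun i => eLpNorm (fun x => f i x - g x) p μ) l (𝓝 0)) :
    Tendsto (fun ij : ι × ι => eLpNorm (fun x => f ij.1 x - f ij.2 x) p μ) (l ×ˢ l) (𝓝 0) := by
  have hsum : Tendsto (fun ij : ι × ι => eLpNorm (fun x => f ij.1 x - g x) p μ
      + eLpNorm (fun x => f ij.2 x - g x) p μ) (l ×ˢ l) (𝓝 0) := by
    simpa using (hlim.comp tendsto_fst).add (hlim.comp tendsto_snd)
  refine tendsto_of_tendsto_of_tendsto_of_le_of_le' tendsto_const_nhds hsum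
    (.of_forall fun _ => zero_le) ?_
  filter_upwards [hf.prod_mk hf] with ij hij
  have hsub : (fun x => f ij.1 x - f ij.2 x)
      = (fun x => f ij.1 x - g x) - fun x => f ij.2 x - g x := by
    ext x
    simp
  rw [hsub]
  exact eLpNorm_sub_le (hij.1.sub hg).1 (hij.2.sub hg).1 hp

theorem exists_tendsto_eLpNorm_sub [CompleteSpace E] [l.NeBot] (hp : 1 ≤ p)
    (hf : ∀ᶠ i in l, MemLp (f i) p μ)
    (hcauchy : Tendsto (fun ij : ι × ι => eLpNorm (fun x => f ij.1 x - f ij.2 x) p μ)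
      (l ×ˢ l) (𝓝 0)) :
    ∃ g : α → E, MemLp g p μ ∧ Tendsto (fun i => eLpNorm (fun x => f i x - g x) p μ) l (𝓝 0) := by
  classical
  have : Fact (1 ≤ p) := ⟨hp⟩
  let F : ι → Lp E p μ := fun i => if hi : MemLp (f i) p μ then hi.toLp (f i) else 0
  have hF {i} (hi : MemLp (f i) p μ) : F i = hi.toLp (f i) := dif_pos hi
  have hmap : Cauchy (map F l) := by
    refine cauchy_map_iff.2 ⟨‹_›, uniformity_basis_edist.tendsto_right_iff.2 fun ε hε => ?_⟩
    filter_upwards [hf.prod_mk hf, hcauchy.eventually (gt_mem_nhds hε)] with ij hij hlt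
    change edist (F ij.1) (F ij.2) < ε
    rw [hF hij.1, hF hij.2, Lp.edist_toLp_toLp]
    exact hlt
  obtain ⟨g, hg⟩ := CompleteSpace.complete hmap
  refine ⟨g, Lp.memLp g, (tendsto_iff_edist_tendsto_0.1 hg).congr' (hf.mono fun i hi => ?_)⟩
  rw [hF hi, Lp.edist_def]
  refine eLpNorm_congr_ae ?_
  filter_upwards [hi.coeFn_toLp] with x hx
  simp [hx]

end LpLimits

theorem eLpNorm_sub_eq_zero_of_ae_eq {α E : Type*} [MeasurableSpace α] {μ : Measure α}
    [NormedAddCommGroup E] {f g : α → E} (h : f =ᵐ[μ] g) (p : ℝ≥0∞) :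
    eLpNorm (fun x => f x - g x) p μ = 0 :=
  (eLpNorm_congr_ae (h.mono fun _ => sub_eq_zero.2)).trans eLpNorm_zero

section AddMeasure

variable {α E : Type*} [MeasurableSpace α] {μ ν : Measure α} [NormedAddCommGroup E] {p : ℝ≥0∞}

theorem eLpNorm_add_measure_le (hp : 1 ≤ p) (f : α → E) :
    eLpNorm f p (μ + ν) ≤ eLpNorm f p μ + eLpNorm f p ν := by
  rcases eq_or_ne p ⊤ with rfl | hp_top
  · simp only [eLpNorm_exponent_top]
    refine eLpNormEssSup_le_of_ae_enorm_bound (ae_add_measure_iff.2 ⟨?_, ?_⟩)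
    · exact (enorm_ae_le_eLpNormEssSup f μ).mono fun x hx => hx.trans le_self_add
    · exact (enorm_ae_le_eLpNormEssSup f ν).mono fun x hx => hx.trans le_add_self
  · have hp₀ : p ≠ 0 := (one_pos.trans_le hp).ne'
    simp only [eLpNorm_eq_lintegral_rpow_enorm_toReal hp₀ hp_top, lintegral_add_measure]
    refine ENNReal.rpow_add_le_add_rpow _ _ (by positivity) ?_
    rw [one_div]
    exact inv_le_one_of_one_le₀ (ENNReal.toReal_mono hp_top hp)

theorem memLp_add_measure {f : α → E} (hp : 1 ≤ p) (hμ : MemLp f p μ) (hν : MemLp f p ν) :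
    MemLp f p (μ + ν) :=
  ⟨aestronglyMeasurable_add_measure_iff.2 ⟨hμ.1, hν.1⟩,
    (eLpNorm_add_measure_le hp f).trans_lt (ENNReal.add_lt_top.2 ⟨hμ.2, hν.2⟩)⟩

end AddMeasure

section Averages

variable {α β E : Type*} [MeasurableSpace α] [MeasurableSpace β] [NormedAddCommGroup E]
  [NormedSpace ℝ E] {μ : Measure α} {ν : Measure β} {p : NNReal}

theorem lintegral_rpow_le_lintegral_rpow [IsProbabilityMeasure ν] (hp : 1 ≤ p) {h : β → ℝ≥0∞}
    (hh : AEMeasurable h ν) : (∫⁻ y, h y ∂ν) ^ (p : ℝ) ≤ ∫⁻ y, h y ^ (p : ℝ) ∂ν := by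
  have hle := eLpNorm_le_eLpNorm_of_exponent_le (p := 1) (q := p) (μ := ν) (mod_cast hp)
    hh.aestronglyMeasurable
  rw [eLpNorm_one_eq_lintegral_enorm] at hle
  calc (∫⁻ y, h y ∂ν) ^ (p : ℝ) ≤ eLpNorm h p ν ^ (p : ℝ) := by gcongr; simpa using hle
    _ = ∫⁻ y, h y ^ (p : ℝ) ∂ν := by
      simpa using eLpNorm_nnreal_pow_eq_lintegral (f := h) (μ := ν) (zero_lt_one.trans_le hp).ne'

theorem enorm_integral_sub_le_lintegral_enorm_sub [CompleteSpace E] [IsProbabilityMeasure ν]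
    {h : β → E} (hh : AEStronglyMeasurable h ν) (c : E) :
    ‖(∫ y, h y ∂ν) - c‖ₑ ≤ ∫⁻ y, ‖h y - c‖ₑ ∂ν := by
  by_cases hint : Integrable h ν
  · have : (∫ y, h y ∂ν) - c = ∫ y, (h y - c) ∂ν := by
      simp [integral_sub hint (integrable_const c)]
    exact this ▸ enorm_integral_le_lintegral_enorm _
  · have : ∫⁻ y, ‖h y - c‖ₑ ∂ν = ⊤ := by
      by_contra hfin
      refine hint ?_
      have hsub : Integrable (fun y => h y - c) ν :=
        ⟨hh.sub aestronglyMeasurable_const, lt_top_iff_ne_top.2 hfin⟩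
      exact (hsub.add (integrable_const c)).congr (.of_forall fun y => sub_add_cancel _ _)
    simp [this]

theorem eLpNorm_integral_sub_le [CompleteSpace E] [SFinite μ] [IsProbabilityMeasure ν]
    (hp : 1 ≤ p) {F : α → β → E} (hF : StronglyMeasurable (Function.uncurry F)) {f : α → E}
    (hf : StronglyMeasurable f) {B : ℝ≥0∞}
    (hB : ∀ᵐ y ∂ν, eLpNorm (fun x => F x y - f x) p μ ≤ B) :
    eLpNorm (fun x => (∫ y, F x y ∂ν) - f x) p μ ≤ B := by
  have hp0 : p ≠ 0 := (zero_lt_one.trans_le hp).ne'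
  have hF' (x) : StronglyMeasurable (F x) := hF.comp_measurable measurable_prodMk_left
  have hmeas : StronglyMeasurable fun z : α × β => F z.1 z.2 - f z.1 :=
    hF.sub (hf.comp_measurable measurable_fst)
  have hp0' : (0 : ℝ) < p := by positivity
  rw [← ENNReal.rpow_le_rpow_iff hp0', eLpNorm_nnreal_pow_eq_lintegral hp0]
  calc ∫⁻ x, ‖(∫ y, F x y ∂ν) - f x‖ₑ ^ (p : ℝ) ∂μ
      ≤ ∫⁻ x, ∫⁻ y, ‖F x y - f x‖ₑ ^ (p : ℝ) ∂ν ∂μ := by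
        refine lintegral_mono fun x => le_trans ?_ (lintegral_rpow_le_lintegral_rpow hp
          ((hF' x).sub stronglyMeasurable_const).enorm.aemeasurable)
        gcongr
        exact enorm_integral_sub_le_lintegral_enorm_sub (hF' x).aestronglyMeasurable _
    _ = ∫⁻ y, ∫⁻ x, ‖F x y - f x‖ₑ ^ (p : ℝ) ∂μ ∂ν :=
        lintegral_lintegral_swap (hmeas.enorm.pow_const _).aemeasurable
    _ ≤ ∫⁻ _, B ^ (p : ℝ) ∂ν := by
        refine lintegral_mono_ae (hB.mono fun y hy => ?_)
        rw [← eLpNorm_nnreal_pow_eq_lintegral hp0]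
        gcongr
    _ = B ^ (p : ℝ) := by simp

theorem eLpNorm_const_average_le [IsFiniteMeasure μ] {q : ℝ≥0∞} (hq : 1 ≤ q) {v : α → E}
    (hv : AEStronglyMeasurable v μ) : eLpNorm (fun _ => ⨍ y, v y ∂μ) q μ ≤ eLpNorm v q μ := by
  rcases eq_or_ne μ 0 with rfl | hμ
  · simp
  have : NeZero μ := ⟨hμ⟩
  have hμ' : μ univ ≠ 0 := by simpa using hμ
  set ν := (μ univ)⁻¹ • μ with hν
  have hμν : μ = μ univ • ν := by
    rw [hν, smul_smul, ENNReal.mul_inv_cancel hμ' (measure_ne_top _ _), one_smul]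
  rw [hμν, eLpNorm_smul_measure_of_ne_zero hμ', eLpNorm_smul_measure_of_ne_zero hμ', ← hμν]
  gcongr
  calc eLpNorm (fun _ => ∫ y, v y ∂ν) q ν = ‖∫ y, v y ∂ν‖ₑ := by
        rw [eLpNorm_const _ (zero_lt_one.trans_le hq).ne' (NeZero.ne ν)]
        simp
    _ ≤ eLpNorm v 1 ν := by
        rw [eLpNorm_one_eq_lintegral_enorm]
        exact enorm_integral_le_lintegral_enorm _
    _ ≤ eLpNorm v q ν := eLpNorm_le_eLpNorm_of_exponent_le hq (hv.smul_measure _)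

theorem eLpNorm_sub_average_le [IsFiniteMeasure μ] {q : ℝ≥0∞} (hq : 1 ≤ q) {v : α → E}
    (hv : AEStronglyMeasurable v μ) :
    eLpNorm (fun x => v x - ⨍ y, v y ∂μ) q μ ≤ 2 * eLpNorm v q μ :=
  calc eLpNorm (fun x => v x - ⨍ y, v y ∂μ) q μ
      ≤ eLpNorm v q μ + eLpNorm (fun _ => ⨍ y, v y ∂μ) q μ :=
        eLpNorm_sub_le hv aestronglyMeasurable_const hq
    _ ≤ 2 * eLpNorm v q μ := by
        rw [two_mul]
        gcongr
        exact eLpNorm_const_average_le hq hv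

end Averages

section AsymptoticRates

theorem eq_zero_of_tendsto_of_tendsto_deriv {f f' : ℝ → ℝ} {T a c : ℝ}
    (hf : ∀ t, T < t → HasDerivAt f (f' t) t) (ha : Tendsto f atTop (𝓝 a))
    (hc : Tendsto f' atTop (𝓝 c)) : c = 0 := by
  have hmean : ∀ t, T < t → ∃ ξ, t < ξ ∧ f' ξ = f (t + 1) - f t := fun t ht => by
    obtain ⟨ξ, hξ, hslope⟩ := exists_hasDerivAt_eq_slope f f' (lt_add_one t)
      (fun x hx => (hf x (ht.trans_le hx.1)).continuousAt.continuousWithinAt)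
      (fun x hx => hf x (ht.trans hx.1))
    exact ⟨ξ, hξ.1, by simpa using hslope⟩
  choose! ξ hξ hslope using hmean
  have hT := eventually_gt_atTop T
  have hξlim : Tendsto ξ atTop atTop :=
    tendsto_atTop_mono' _ (hT.mono fun t ht => (hξ t ht).le) tendsto_id
  have hincr : Tendsto (fun t => f (t + 1) - f t) atTop (𝓝 (a - a)) :=
    (ha.comp (tendsto_atTop_add_const_right _ 1 tendsto_id)).sub ha
  rw [sub_self] at hincr
  exact tendsto_nhds_unique ((hc.comp hξlim).congr' (hT.mono hslope)) hincr

theorem exists_eq_mul_add_of_hasDerivAt {f : ℝ → ℝ} {T a : ℝ}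
    (hf : ∀ t, T < t → HasDerivAt f a t) : ∃ C, ∀ t, T < t → f t = a * t + C := by
  have hderiv : ∀ t ∈ Ioi T, HasDerivAt (fun τ => f τ - a * τ) 0 t := fun t ht => by
    simpa using (hf t ht).fun_sub ((hasDerivAt_id t).const_mul a)
  obtain ⟨C, hC⟩ := isOpen_Ioi.exists_is_const_of_deriv_eq_zero isPreconnected_Ioi
    (fun t ht => (hderiv t ht).differentiableAt.differentiableWithinAt)
    (fun t ht => (hderiv t ht).deriv)
  exact ⟨C, fun t ht => sub_eq_iff_eq_add'.1 (hC t ht)⟩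

end AsymptoticRates

section AffineMaps

open Module

variable {E F : Type*} [NormedAddCommGroup E] [NormedSpace ℝ E] [MeasurableSpace E] [BorelSpace E]

theorem measurableEmbedding_smul_add {s : ℝ} (hs : s ≠ 0) (c : E) :
    MeasurableEmbedding fun x => s • x + c :=
  ((Homeomorph.smulOfNeZero s hs).trans (Homeomorph.addRight c)).measurableEmbedding

variable [FiniteDimensional ℝ E] {μ : Measure E} [μ.IsAddHaarMeasure] [NormedAddCommGroup F]

theorem map_smul_add_addHaar {s : ℝ} (hs : s ≠ 0) (c : E) :
    Measure.map (fun x => s • x + c) μ = ENNReal.ofReal |(s ^ finrank ℝ E)⁻¹| • μ := by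
  have h : (fun x : E => s • x + c) = (· + c) ∘ (s • ·) := rfl
  rw [h, ← Measure.map_map (by fun_prop) (by fun_prop), Measure.map_addHaar_smul _ hs,
    Measure.map_smul, map_add_right_eq_self]

theorem lintegral_comp_smul_add (h : E → ℝ≥0∞) {s : ℝ} (hs : s ≠ 0) (c : E) :
    ∫⁻ x, h (s • x + c) ∂μ = ENNReal.ofReal |(s ^ finrank ℝ E)⁻¹| * ∫⁻ x, h x ∂μ := by
  rw [← (measurableEmbedding_smul_add hs c).lintegral_map, map_smul_add_addHaar hs,
    lintegral_smul_measure, smul_eq_mul]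

theorem eLpNorm_comp_smul_add (f : E → F) (p : ℝ≥0∞) {s : ℝ} (hs : s ≠ 0) (c : E) :
    eLpNorm (fun x => f (s • x + c)) p μ
      = ENNReal.ofReal |(s ^ finrank ℝ E)⁻¹| ^ (1 / p).toReal * eLpNorm f p μ := by
  have h := (measurableEmbedding_smul_add hs c).eLpNorm_map_measure (g := f) (p := p) (μ := μ)
  rw [map_smul_add_addHaar hs, eLpNorm_smul_measure_of_ne_zero (by simp [hs])] at h
  exact h.symm

theorem memLp_comp_smul_add {f : E → F} {p : ℝ≥0∞} (hf : MemLp f p μ) {s : ℝ} (hs : s ≠ 0)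
    (c : E) : MemLp (fun x => f (s • x + c)) p μ := by
  refine (measurableEmbedding_smul_add hs c).memLp_map_measure_iff.1 ?_
  rw [map_smul_add_addHaar hs]
  exact hf.smul_measure (by simp)

theorem tendsto_eLpNorm_comp_smul_add_sub_of_hasCompactSupport {g : E → F} (hg : Continuous g)
    (hgc : HasCompactSupport g) {p : NNReal} (hp : p ≠ 0) :
    Tendsto (fun q : ℝ × E => eLpNorm (fun x => g (q.1 • x + q.2) - g x) p μ) (𝓝 (1, 0))
      (𝓝 0) := by
  obtain ⟨M, hM⟩ := hg.bounded_above_of_compact_support hgc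
  obtain ⟨R, hR, hgR⟩ := hgc.isCompact.isBounded.exists_pos_norm_le
  have hp' : (0 : ℝ) < p := by positivity
  have hnear : ∀ᶠ q : ℝ × E in 𝓝 (1, 0), 1 / 2 < q.1 ∧ ‖q.2‖ < 1 :=
    (continuous_fst.tendsto (1, (0 : E))).eventually (lt_mem_nhds (by norm_num)) |>.and <|
      (continuous_snd.norm.tendsto (1, (0 : E))).eventually (gt_mem_nhds (by simp))
  suffices h : Tendsto (fun q : ℝ × E => ∫⁻ x, ‖g (q.1 • x + q.2) - g x‖ₑ ^ (p : ℝ) ∂μ)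
      (𝓝 (1, 0)) (𝓝 0) by
    simp_rw [eLpNorm_nnreal_eq_lintegral hp]
    simpa [hp'] using h.ennrpow_const (1 / (p : ℝ))
  rw [← lintegral_zero (μ := μ)]
  refine tendsto_lintegral_filter_of_dominated_convergence
    ((Metric.closedBall 0 (2 * (R + 1))).indicator fun _ => ENNReal.ofReal (2 * M) ^ (p : ℝ))
    (.of_forall fun q => ?_) (hnear.mono fun q hq => .of_forall fun x => ?_) ?_
    (.of_forall fun x => ?_)
  · exact (Continuous.enorm (by fun_prop)).measurable.pow_const _
  · by_cases hx : x ∈ Metric.closedBall 0 (2 * (R + 1))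
    · rw [indicator_of_mem hx, ← ofReal_norm]
      gcongr
      linarith [norm_sub_le (g (q.1 • x + q.2)) (g x), hM (q.1 • x + q.2), hM x]
    · have hxR : 2 * (R + 1) < ‖x‖ := by simpa using hx
      have hfar : R < ‖q.1 • x + q.2‖ := by
        have := norm_sub_le (q.1 • x + q.2) q.2
        rw [add_sub_cancel_right, norm_smul, Real.norm_of_nonneg (by linarith)] at this
        nlinarith
      have hzero (y : E) (hy : R < ‖y‖) : g y = 0 :=
        image_eq_zero_of_notMem_tsupport fun hmem => (hgR y hmem).not_gt hy
      simp [hzero _ hfar, hzero x (by linarith), hp']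
  · rw [lintegral_indicator_const measurableSet_closedBall]
    exact ENNReal.mul_ne_top (ENNReal.rpow_ne_top_of_nonneg hp'.le ENNReal.ofReal_ne_top)
      (isCompact_closedBall _ _).measure_lt_top.ne
  · have hcont : Continuous fun q : ℝ × E => ‖g (q.1 • x + q.2) - g x‖ₑ ^ (p : ℝ) :=
      ENNReal.continuous_rpow_const.comp (Continuous.enorm (by fun_prop))
    simpa [hp'] using hcont.tendsto (1, 0)

theorem eventually_eLpNorm_comp_smul_add_le (f : E → F) (p : ℝ≥0∞) :
    ∀ᶠ q : ℝ × E in 𝓝 (1, 0), eLpNorm (fun x => f (q.1 • x + q.2)) p μ ≤ 2 * eLpNorm f p μ := by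
  have hfactor : Tendsto (fun q : ℝ × E =>
      ENNReal.ofReal |(q.1 ^ finrank ℝ E)⁻¹| ^ (1 / p).toReal) (𝓝 (1, 0)) (𝓝 1) := by
    have : ContinuousAt (fun q : ℝ × E => |(q.1 ^ finrank ℝ E)⁻¹|) (1, 0) :=
      ((continuousAt_fst.pow _).inv₀ (by simp)).abs
    simpa using ((ENNReal.continuous_ofReal.continuousAt.comp this).tendsto.ennrpow_const
      (1 / p).toReal)
  filter_upwards [hfactor.eventually (gt_mem_nhds ENNReal.one_lt_two),
    (continuous_fst.tendsto (1, (0 : E))).eventually_ne one_ne_zero] with q hq hq0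
  rw [eLpNorm_comp_smul_add f p hq0]
  gcongr

theorem tendsto_eLpNorm_comp_smul_add_sub [NormedSpace ℝ F] {f : E → F} {p : NNReal} (hp : 1 ≤ p)
    (hf : MemLp f p μ) :
    Tendsto (fun q : ℝ × E => eLpNorm (fun x => f (q.1 • x + q.2) - f x) p μ) (𝓝 (1, 0))
      (𝓝 0) := by
  rw [ENNReal.tendsto_nhds_zero]
  intro ε hε
  have hp0 : p ≠ 0 := (zero_lt_one.trans_le hp).ne'
  have hp1 : (1 : ℝ≥0∞) ≤ p := mod_cast hp
  have hδ : ε / 4 ≠ 0 := (ENNReal.div_pos hε.ne' (by simp)).ne'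
  obtain ⟨g, hgc, hfg, hg, hgLp⟩ := hf.exists_hasCompactSupport_eLpNorm_sub_le (by simp) hδ
  have hsmall := (ENNReal.tendsto_nhds_zero.1
    (tendsto_eLpNorm_comp_smul_add_sub_of_hasCompactSupport (μ := μ) hg hgc hp0)) (ε / 4)
    (pos_iff_ne_zero.2 hδ)
  filter_upwards [hsmall, eventually_eLpNorm_comp_smul_add_le (μ := μ) (f - g) p,
    (continuous_fst.tendsto (1, (0 : E))).eventually_ne one_ne_zero]
    with q hgq hfgq hq0
  have hf' := memLp_comp_smul_add hf hq0 q.2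
  have hg' := memLp_comp_smul_add hgLp hq0 q.2
  calc eLpNorm (fun x => f (q.1 • x + q.2) - f x) p μ
      = eLpNorm ((fun x => (f - g) (q.1 • x + q.2)) + (fun x => g (q.1 • x + q.2) - g x)
          - (f - g)) p μ := by
        congr 1; ext x; simp
    _ ≤ eLpNorm (fun x => (f - g) (q.1 • x + q.2)) p μ
          + eLpNorm (fun x => g (q.1 • x + q.2) - g x) p μ + eLpNorm (f - g) p μ :=
        (eLpNorm_sub_le ((hf'.sub hg').1.add (hg'.sub hgLp).1) (hf.sub hgLp).1 hp1).trans <| by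
          gcongr
          exact eLpNorm_add_le (hf'.sub hg').1 (hg'.sub hgLp).1 hp1
    _ ≤ 2 * (ε / 4) + ε / 4 + ε / 4 := by
        gcongr
        exact hfgq.trans (by gcongr)
    _ = ε := by
        rw [add_assoc, ← two_mul, ← add_mul, two_add_two_eq_four, ENNReal.mul_div_cancel]
          <;> simp

end AffineMaps

section Gradient

variable {E : Type*} [NormedAddCommGroup E] [InnerProductSpace ℝ E] [CompleteSpace E]
  {φ ψ : E → ℝ} {x : E}

theorem gradient_fun_mul (hφ : DifferentiableAt ℝ φ x) (hψ : DifferentiableAt ℝ ψ x) :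
    ∇ (fun y => φ y * ψ y) x = φ x • ∇ ψ x + ψ x • ∇ φ x := by
  simp [gradient, fderiv_fun_mul hφ hψ]

theorem gradient_fun_add (hφ : DifferentiableAt ℝ φ x) (hψ : DifferentiableAt ℝ ψ x) :
    ∇ (fun y => φ y + ψ y) x = ∇ φ x + ∇ ψ x := by
  simp [gradient, fderiv_fun_add hφ hψ]

theorem norm_gradient (φ : E → ℝ) (x : E) : ‖∇ φ x‖ = ‖fderiv ℝ φ x‖ := by
  simp [gradient]

theorem gradient_comp_smul_add (φ : E → ℝ) (s : ℝ) (c x : E) :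
    ∇ (fun y => φ (s • y + c)) x = s • ∇ φ (s • x + c) := by
  have h := fderiv_comp_smul (f := fun y => φ (y + c)) (c := s) (x := x) (𝕜 := ℝ)
  simp [gradient, h, fderiv_comp_add_right]

theorem gradient_comp_const_sub (φ : E → ℝ) (z x : E) :
    ∇ (fun y => φ (z - y)) x = -∇ φ (z - x) := by
  simpa [neg_add_eq_sub] using gradient_comp_smul_add φ (-1) z x

theorem continuous_gradient (hφ : ContDiff ℝ 1 φ) : Continuous (∇ φ) :=
  (InnerProductSpace.toDual ℝ E).symm.continuous.comp (hφ.continuous_fderiv one_ne_zero)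

theorem tsupport_gradient_subset (φ : E → ℝ) : tsupport (∇ φ) ⊆ tsupport φ := by
  refine (closure_mono fun x hx => ?_).trans (tsupport_fderiv_subset ℝ (f := φ))
  simpa [gradient] using hx

theorem gradient_eq_zero_of_notMem_tsupport (hx : x ∉ tsupport φ) : ∇ φ x = 0 :=
  image_eq_zero_of_notMem_tsupport fun h => hx (tsupport_gradient_subset φ h)

end Gradient

section ContractedAverage

open Module
open scoped Convolution

variable {E F : Type*} [NormedAddCommGroup E] [NormedSpace ℝ E] [MeasureSpace E]
  [NormedAddCommGroup F] [NormedSpace ℝ F]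

/-- The average of `f`, with weight `k`, over the copy of `E` contracted by the factor `θ` towards
`x`. If `x` and the support of `k` lie in a convex set, it only depends on the values of `f` in
that set. It smooths functions on a convex domain without leaving the domain. -/
noncomputable def contractedAverage (k : E → ℝ) (θ : ℝ) (f : E → F) (x : E) : F :=
  ∫ y, k y • f ((1 - θ) • x + θ • y)

variable [BorelSpace E] [FiniteDimensional ℝ E] [(volume : Measure E).IsAddHaarMeasure]

theorem contractedAverage_eq_convolution (k : E → ℝ) {θ : ℝ} (hθ : θ ≠ 0) (f : E → F) (x : E) :
    contractedAverage k θ f x = ((fun t => |((-θ) ^ finrank ℝ E)⁻¹| * k (-θ⁻¹ • t))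
      ⋆[ContinuousLinearMap.lsmul ℝ ℝ, volume] f) ((1 - θ) • x) := by
  have h := Measure.integral_comp_smul volume
    (fun t => k (-θ⁻¹ • t) • f ((1 - θ) • x - t)) (-θ)
  simp only [neg_smul, smul_neg, neg_neg, inv_smul_smul₀ hθ, sub_neg_eq_add] at h
  simp only [convolution_lsmul, mul_smul, integral_smul, contractedAverage, h, neg_smul]

theorem contDiff_contractedAverage {k : E → ℝ} (hk : ContDiff ℝ ∞ k) (hkc : HasCompactSupport k)
    {θ : ℝ} (hθ : θ ≠ 0) {f : E → F} (hf : LocallyIntegrable f) :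
    ContDiff ℝ ∞ (contractedAverage k θ f) := by
  simp_rw [funext (contractedAverage_eq_convolution k hθ f)]
  have hc : HasCompactSupport fun t => |((-θ) ^ finrank ℝ E)⁻¹| * k (-θ⁻¹ • t) :=
    (hkc.comp_smul (neg_ne_zero.2 (inv_ne_zero hθ))).mul_left
  exact (hc.contDiff_convolution_left (ContinuousLinearMap.lsmul ℝ ℝ) (n := ⊤)
    (contDiff_const.mul (hk.comp (contDiff_const_smul _))) hf).comp (contDiff_const_smul _)

theorem tendsto_eLpNorm_contractedAverage_sub [CompleteSpace F] {k : E → ℝ} (hk : Continuous k)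
    (hkc : HasCompactSupport k) (hk0 : 0 ≤ k) (hk1 : ∫ y, k y = 1) {p : NNReal} (hp : 1 ≤ p)
    {f : E → F} (hf : MemLp f p) (hfm : StronglyMeasurable f) :
    Tendsto (fun θ => eLpNorm (fun x => contractedAverage k θ f x - f x) p) (𝓝 0) (𝓝 0) := by
  set ν := (volume : Measure E).withDensity fun y => ENNReal.ofReal (k y) with hν
  have hkm : Measurable fun y => ENNReal.ofReal (k y) := (by fun_prop)
  have hprob : IsProbabilityMeasure ν := by
    refine ⟨?_⟩
    rw [hν, withDensity_apply _ .univ, setLIntegral_univ, ← ofReal_integral_eq_lintegral_ofReal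
      (hk.integrable_of_hasCompactSupport hkc) (.of_forall hk0), hk1, ENNReal.ofReal_one]
  have haverage (θ : ℝ) (x : E) :
      contractedAverage k θ f x = ∫ y, f ((1 - θ) • x + θ • y) ∂ν := by
    rw [hν, integral_withDensity_eq_integral_toReal_smul hkm (by simp)]
    simp_rw [ENNReal.toReal_ofReal (hk0 _), contractedAverage]
  have hsupp : ∀ᵐ y ∂ν, y ∈ tsupport k := by
    rw [hν, ae_withDensity_iff hkm]
    refine .of_forall fun y hy => subset_tsupport k fun hzero => hy (by simp [hzero])
  rw [ENNReal.tendsto_nhds_zero]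
  intro ε hε
  have htranslate := ENNReal.tendsto_nhds_zero.1
    (tendsto_eLpNorm_comp_smul_add_sub (μ := volume) hp hf) ε hε
  have hunif : ∀ᶠ θ : ℝ in 𝓝 0, ∀ y ∈ tsupport k,
      eLpNorm (fun x => f ((1 - θ) • x + θ • y) - f x) p ≤ ε := by
    refine hkc.isCompact.eventually_forall_of_forall_eventually fun y _ => ?_
    have hcont : Continuous fun z : ℝ × E => (1 - z.1, z.1 • z.2) := by fun_prop
    exact (hcont.tendsto' _ (1, (0 : E)) (by simp)).eventually htranslate
  filter_upwards [hunif] with θ hθ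
  simp_rw [haverage]
  exact eLpNorm_integral_sub_le (F := fun x y => f ((1 - θ) • x + θ • y)) hp
    (hfm.comp_measurable (by fun_prop)) hfm (hsupp.mono hθ)

theorem tendsto_eLpNorm_contractedAverage_indicator_sub [CompleteSpace F] {k : E → ℝ}
    (hk : Continuous k) (hkc : HasCompactSupport k) (hk0 : 0 ≤ k) (hk1 : ∫ y, k y = 1)
    {p : NNReal} (hp : 1 ≤ p) {K : Set E} (hK : MeasurableSet K) {f : E → F}
    (hf : MemLp f p (volume.restrict K)) (hfm : StronglyMeasurable f) :
    Tendsto (fun θ => eLpNorm (fun x => contractedAverage k θ (K.indicator f) x - f x) p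
      (volume.restrict K)) (𝓝 0) (𝓝 0) := by
  have hf' : MemLp (K.indicator f) p volume := (memLp_indicator_iff_restrict hK).2 hf
  have hlim := tendsto_eLpNorm_contractedAverage_sub hk hkc hk0 hk1 hp hf' (hfm.indicator hK)
  refine tendsto_of_tendsto_of_tendsto_of_le_of_le tendsto_const_nhds hlim (fun _ => zero_le)
    fun θ => ?_
  refine le_of_eq_of_le (eLpNorm_congr_ae ?_) (eLpNorm_mono_measure _ Measure.restrict_le_self)
  filter_upwards [ae_restrict_mem hK] with x hx
  rw [indicator_of_mem hx]

end ContractedAverage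

section Density

open Module
open scoped Convolution

theorem HasH1Gradient.congr_ae {D : Set Plane} {u u' : Plane → ℝ} {G G' : Plane → Plane}
    (h : HasH1Gradient D u G) (hu : u =ᵐ[volume.restrict D] u')
    (hG : G =ᵐ[volume.restrict D] G') : HasH1Gradient D u' G' where
  memLp := (memLp_congr_ae hu).1 h.memLp
  memLp_gradient := (memLp_congr_ae hG).1 h.memLp_gradient
  weak_gradient φ hφ := by
    rw [integral_congr_ae (hu.symm.mono fun x hx => congrArg (· • ∇ φ x) hx),
      integral_congr_ae (hG.symm.mono fun x hx => congrArg (φ x • ·) hx)]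
    exact h.weak_gradient φ hφ

theorem HasH1Gradient.hasGradientAt_convolution {K : Set Plane} (hK : MeasurableSet K)
    {u : Plane → ℝ} {G : Plane → Plane} (h : HasH1Gradient K u G) {k : Plane → ℝ} {z : Plane}
    (hk : IsTestFunction K fun t => k (z - t)) :
    HasGradientAt (k ⋆[ContinuousLinearMap.lsmul ℝ ℝ, volume] K.indicator u)
      ((k ⋆[ContinuousLinearMap.lsmul ℝ ℝ, volume] K.indicator G) z) z := by
  have hk' : k = fun t => (fun t => k (z - t)) (z - t) := by simp
  have hk_contDiff : ContDiff ℝ ∞ k := hk' ▸ hk.1.comp (contDiff_const.sub contDiff_id)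
  have hk_support : HasCompactSupport k := hk' ▸ hk.2.1.comp_homeomorph (Homeomorph.subLeft z)
  have hfderiv := hk_support.hasFDerivAt_convolution_left (ContinuousLinearMap.lsmul ℝ ℝ)
    (hk_contDiff.of_le (by simp)) (((memLp_indicator_iff_restrict hK).2 h.memLp).locallyIntegrable
      one_le_two) z
  have hgradient : (k ⋆[ContinuousLinearMap.lsmul ℝ ℝ, volume] K.indicator G) z
      = ∫ t in K, u t • ∇ k (z - t) :=
    calc (k ⋆[ContinuousLinearMap.lsmul ℝ ℝ, volume] K.indicator G) z
        = ∫ t in K, k (z - t) • G t := by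
          rw [convolution_lsmul_swap, ← integral_indicator hK]
          simp_rw [indicator_smul_apply]
      _ = -∫ t in K, u t • ∇ (fun t => k (z - t)) t := by
          rw [h.weak_gradient _ hk, neg_neg]
      _ = ∫ t in K, u t • ∇ k (z - t) := by
          simp_rw [gradient_comp_const_sub, smul_neg, integral_neg, neg_neg]
  rw [hasGradientAt_iff_hasFDerivAt, hgradient]
  refine hfderiv.congr_fderiv ?_
  calc (fderiv ℝ k ⋆[ContinuousLinearMap.precompL Plane (ContinuousLinearMap.lsmul ℝ ℝ), volume]
        K.indicator u) z
      = ∫ t in K, InnerProductSpace.toDual ℝ Plane (u t • ∇ k (z - t)) := by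
        rw [convolution_eq_swap, ← integral_indicator hK]
        congr 1 with t v
        by_cases ht : t ∈ K <;> simp [ht, gradient, ContinuousLinearMap.precompL_apply, mul_comm]
    _ = InnerProductSpace.toDual ℝ Plane (∫ t in K, u t • ∇ k (z - t)) :=
        ((InnerProductSpace.toDual ℝ Plane).toContinuousLinearEquiv :
          Plane ≃L[ℝ] StrongDual ℝ Plane).integral_comp_comm _

theorem isTestFunction_contracted {K : Set Plane} (hK : Convex ℝ K) {k : Plane → ℝ}
    (hk : IsTestFunction K k) {θ : ℝ} (hθ : θ ∈ Ioc 0 1) {x : Plane} (hx : x ∈ K) (c : ℝ) :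
    IsTestFunction K fun t => c * k (-θ⁻¹ • ((1 - θ) • x - t)) := by
  have hsub : (fun t => k (-θ⁻¹ • ((1 - θ) • x - t)))
      = k ∘ ((Homeomorph.subLeft ((1 - θ) • x)).trans
        (Homeomorph.smulOfNeZero (-θ⁻¹) (neg_ne_zero.2 (inv_ne_zero hθ.1.ne')))) := rfl
  refine ⟨contDiff_const.mul (hk.1.comp (by fun_prop)), ?_, ?_⟩
  · exact HasCompactSupport.mul_left (hsub ▸ hk.2.1.comp_homeomorph _)
  · refine (tsupport_mul_subset_right (f := fun _ => c)).trans ?_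
    rw [hsub, tsupport_comp_eq_preimage]
    intro t ht
    have := hK hx (hk.2.2 ht) (sub_nonneg.2 hθ.2) hθ.1.le (by ring)
    simpa [smul_smul, hθ.1.ne'] using this

theorem HasH1Gradient.gradient_contractedAverage {K : Set Plane} (hKo : MeasurableSet K)
    (hKc : Convex ℝ K) {u : Plane → ℝ} {G : Plane → Plane} (h : HasH1Gradient K u G)
    {k : Plane → ℝ} (hk : IsTestFunction K k) {θ : ℝ} (hθ : θ ∈ Ioc 0 1) {x : Plane}
    (hx : x ∈ K) : ∇ (contractedAverage k θ (K.indicator u)) x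
      = (1 - θ) • contractedAverage k θ (K.indicator G) x := by
  have hgrad := (h.hasGradientAt_convolution hKo (z := (1 - θ) • x)
    (k := fun t => |((-θ) ^ finrank ℝ Plane)⁻¹| * k (-θ⁻¹ • t))
    (isTestFunction_contracted hKc hk hθ hx _)).gradient
  rw [contractedAverage_eq_convolution k hθ.1.ne', ← hgrad]
  simp_rw [funext (contractedAverage_eq_convolution k hθ.1.ne' _)]
  simpa using gradient_comp_smul_add ((fun t => |((-θ) ^ finrank ℝ Plane)⁻¹| * k (-θ⁻¹ • t))
    ⋆[ContinuousLinearMap.lsmul ℝ ℝ, volume] K.indicator u) (1 - θ) 0 x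

theorem exists_isTestFunction_integral_eq_one {K : Set Plane} (hK : IsOpen K) (hne : K.Nonempty) :
    ∃ k, IsTestFunction K k ∧ 0 ≤ k ∧ ∫ y, k y = 1 := by
  obtain ⟨x₀, hx₀⟩ := hne
  obtain ⟨r, hr, hrK⟩ := Metric.nhds_basis_closedBall.mem_iff.1 (hK.mem_nhds hx₀)
  let ρ : ContDiffBump x₀ := ⟨r / 2, r, half_pos hr, half_lt_self hr⟩
  exact ⟨ρ.normed volume, ⟨ρ.contDiff_normed, ρ.hasCompactSupport_normed,
    ρ.tsupport_normed_eq.trans_subset hrK⟩, fun x => ρ.nonneg_normed x, ρ.integral_normed⟩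

theorem HasH1Gradient.tendsto_eLpNorm_gradient_contractedAverage_sub {K : Set Plane}
    (hK : MeasurableSet K) (hKc : Convex ℝ K) {u : Plane → ℝ} {G : Plane → Plane}
    (h : HasH1Gradient K u G) (hG : StronglyMeasurable G) {k : Plane → ℝ}
    (hk : IsTestFunction K k) (hk0 : 0 ≤ k) (hk1 : ∫ y, k y = 1) :
    Tendsto (fun θ => eLpNorm (fun x => ∇ (contractedAverage k θ (K.indicator u)) x - G x) 2
      (volume.restrict K)) (𝓝[>] 0) (𝓝 0) := by
  set M : ℝ → Plane → Plane := fun θ => contractedAverage k θ (K.indicator G)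
  have hM : Tendsto (fun θ => eLpNorm (M θ - G) 2 (volume.restrict K)) (𝓝[>] 0) (𝓝 0) :=
    (tendsto_eLpNorm_contractedAverage_indicator_sub (p := 2) hk.1.continuous hk.2.1 hk0 hk1
      one_le_two hK (mod_cast h.memLp_gradient) hG).mono_left nhdsWithin_le_nhds
  have hbound : Tendsto (fun θ : ℝ => ‖1 - θ‖ₑ * eLpNorm (M θ - G) 2 (volume.restrict K)
      + ‖θ‖ₑ * eLpNorm G 2 (volume.restrict K)) (𝓝[>] 0) (𝓝 0) := by
    have hid : Tendsto (fun θ : ℝ => θ) (𝓝[>] 0) (𝓝 0) := tendsto_id.mono_left nhdsWithin_le_nhds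
    have h1 : Tendsto (fun θ : ℝ => ‖1 - θ‖ₑ) (𝓝[>] 0) (𝓝 1) := by
      simpa using (hid.const_sub 1).enorm
    have h2 : Tendsto (fun θ : ℝ => ‖θ‖ₑ) (𝓝[>] 0) (𝓝 0) := by simpa using hid.enorm
    simpa using (ENNReal.Tendsto.mul h1 (Or.inl one_ne_zero) hM
      (Or.inr ENNReal.one_ne_top)).add (ENNReal.Tendsto.mul_const h2 (Or.inr h.memLp_gradient.2.ne))
  refine tendsto_of_tendsto_of_tendsto_of_le_of_le' tendsto_const_nhds hbound
    (.of_forall fun _ => zero_le) ?_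
  filter_upwards [Ioc_mem_nhdsGT one_pos] with θ hθ
  have hMθ : AEStronglyMeasurable (M θ) (volume.restrict K) :=
    (contDiff_contractedAverage hk.1 hk.2.1 hθ.1.ne' (((memLp_indicator_iff_restrict hK).2
      h.memLp_gradient).locallyIntegrable one_le_two)).continuous.aestronglyMeasurable
  calc eLpNorm (fun x => ∇ (contractedAverage k θ (K.indicator u)) x - G x) 2 (volume.restrict K)
      = eLpNorm ((1 - θ) • (M θ - G) - θ • G) 2 (volume.restrict K) := by
        refine eLpNorm_congr_ae ?_
        filter_upwards [ae_restrict_mem hK] with x hx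
        rw [h.gradient_contractedAverage hK hKc hk hθ hx]
        simp only [Pi.sub_apply, Pi.smul_apply, M]
        module
    _ ≤ ‖1 - θ‖ₑ * eLpNorm (M θ - G) 2 (volume.restrict K)
          + ‖θ‖ₑ * eLpNorm G 2 (volume.restrict K) := by
        rw [← eLpNorm_const_smul, ← eLpNorm_const_smul]
        exact eLpNorm_sub_le ((hMθ.sub h.memLp_gradient.1).const_smul _)
          (h.memLp_gradient.1.const_smul _) one_le_two

theorem HasH1Gradient.exists_contDiff_approx_of_stronglyMeasurable {K : Set Plane} (hK : IsOpen K)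
    (hKc : Convex ℝ K) (hne : K.Nonempty) {u : Plane → ℝ} {G : Plane → Plane}
    (h : HasH1Gradient K u G) (hu : StronglyMeasurable u) (hG : StronglyMeasurable G) :
    ∃ φ : ℕ → Plane → ℝ, (∀ n, ContDiff ℝ ∞ (φ n)) ∧
      Tendsto (fun n => eLpNorm (fun x => φ n x - u x) 2 (volume.restrict K)) atTop (𝓝 0) ∧
      Tendsto (fun n => eLpNorm (fun x => ∇ (φ n) x - G x) 2 (volume.restrict K)) atTop (𝓝 0) := by
  obtain ⟨k, hk, hk0, hk1⟩ := exists_isTestFunction_integral_eq_one hK hne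
  have hKm := hK.measurableSet
  have hθ : Tendsto (fun n : ℕ => 1 / ((n : ℝ) + 1)) atTop (𝓝[>] 0) :=
    tendsto_nhdsWithin_iff.2 ⟨tendsto_one_div_add_atTop_nhds_zero_nat, .of_forall fun n =>
      mem_Ioi.2 (by positivity)⟩
  refine ⟨fun n => contractedAverage k (1 / ((n : ℝ) + 1)) (K.indicator u), fun n =>
    contDiff_contractedAverage hk.1 hk.2.1 (by positivity)
      (((memLp_indicator_iff_restrict hKm).2 h.memLp).locallyIntegrable one_le_two), ?_,
    (h.tendsto_eLpNorm_gradient_contractedAverage_sub hKm hKc hG hk hk0 hk1).comp hθ⟩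
  exact (tendsto_eLpNorm_contractedAverage_indicator_sub (p := 2) hk.1.continuous hk.2.1 hk0 hk1
    one_le_two hKm (mod_cast h.memLp) hu).comp (hθ.mono_right nhdsWithin_le_nhds)

theorem HasH1Gradient.exists_contDiff_approx {K : Set Plane} (hK : IsOpen K) (hKc : Convex ℝ K)
    (hne : K.Nonempty) {u : Plane → ℝ} {G : Plane → Plane} (h : HasH1Gradient K u G) :
    ∃ φ : ℕ → Plane → ℝ, (∀ n, ContDiff ℝ ∞ (φ n)) ∧
      Tendsto (fun n => eLpNorm (fun x => φ n x - u x) 2 (volume.restrict K)) atTop (𝓝 0) ∧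
      Tendsto (fun n => eLpNorm (fun x => ∇ (φ n) x - G x) 2 (volume.restrict K)) atTop (𝓝 0) := by
  have hu := h.memLp.1
  have hG := h.memLp_gradient.1
  obtain ⟨φ, hφ, hφu, hφG⟩ := (h.congr_ae hu.ae_eq_mk hG.ae_eq_mk)
    |>.exists_contDiff_approx_of_stronglyMeasurable hK hKc hne hu.stronglyMeasurable_mk
      hG.stronglyMeasurable_mk
  refine ⟨φ, hφ, hφu.congr fun n => ?_, hφG.congr fun n => ?_⟩
  · exact eLpNorm_congr_ae (hu.ae_eq_mk.mono fun x hx => by simp only [hx])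
  · exact eLpNorm_congr_ae (hG.ae_eq_mk.mono fun x hx => by simp only [hx])

end Density

section Poincare

open Module
open scoped NNReal

variable {E F : Type*} [NormedAddCommGroup E] [NormedSpace ℝ E] [NormedAddCommGroup F]
  [NormedSpace ℝ F] [CompleteSpace F] {p : ℝ≥0} {φ : E → F}

theorem enorm_sub_rpow_le_lintegral_fderiv (hp : 1 ≤ p) (hφ : ContDiff ℝ 1 φ) (x y : E) :
    ‖φ x - φ y‖ₑ ^ (p : ℝ) ≤ ‖x - y‖ₑ ^ (p : ℝ) *
      ∫⁻ s in Icc (0 : ℝ) 1, ‖fderiv ℝ φ (s • x + (1 - s) • y)‖ₑ ^ (p : ℝ) := by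
  have hcont : Continuous fun s : ℝ => fderiv ℝ φ (s • x + (1 - s) • y) :=
    (hφ.continuous_fderiv one_ne_zero).comp (by fun_prop)
  have hderiv (s : ℝ) : HasDerivAt (fun s : ℝ => φ (s • x + (1 - s) • y))
      (fderiv ℝ φ (s • x + (1 - s) • y) (x - y)) s := by
    have hsegment : HasDerivAt (fun s : ℝ => s • x + (1 - s) • y) (x - y) s := by
      simpa [sub_eq_add_neg] using ((hasDerivAt_id s).smul_const x).fun_add
        (((hasDerivAt_id s).const_sub 1).smul_const y)
    exact (hφ.differentiable one_ne_zero _).hasFDerivAt.comp_hasDerivAt s hsegment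
  have hFTC : φ x - φ y
      = ∫ s in Icc (0 : ℝ) 1, fderiv ℝ φ (s • x + (1 - s) • y) (x - y) := by
    rw [integral_Icc_eq_integral_Ioc, ← intervalIntegral.integral_of_le zero_le_one,
      intervalIntegral.integral_eq_sub_of_hasDerivAt (fun s _ => hderiv s)
        ((hcont.clm_apply continuous_const).intervalIntegrable _ _)]
    simp
  have : IsProbabilityMeasure (volume.restrict (Icc (0 : ℝ) 1)) := ⟨by simp⟩
  calc ‖φ x - φ y‖ₑ ^ (p : ℝ)
      ≤ (∫⁻ s in Icc (0 : ℝ) 1, ‖x - y‖ₑ * ‖fderiv ℝ φ (s • x + (1 - s) • y)‖ₑ) ^ (p : ℝ) := by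
        rw [hFTC]
        gcongr
        refine (enorm_integral_le_lintegral_enorm _).trans (lintegral_mono fun s => ?_)
        rw [mul_comm]
        exact ContinuousLinearMap.le_opENorm _ _
    _ = ‖x - y‖ₑ ^ (p : ℝ) *
          (∫⁻ s in Icc (0 : ℝ) 1, ‖fderiv ℝ φ (s • x + (1 - s) • y)‖ₑ) ^ (p : ℝ) := by
        rw [lintegral_const_mul _ hcont.enorm.measurable,
          ENNReal.mul_rpow_of_nonneg _ _ p.coe_nonneg]
    _ ≤ _ := by
        gcongr
        exact lintegral_rpow_le_lintegral_rpow hp hcont.enorm.aemeasurable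

variable [FiniteDimensional ℝ E] [MeasurableSpace E] [BorelSpace E] (μ : Measure E)
  [μ.IsAddHaarMeasure] {K : Set E}

theorem setLIntegral_comp_convex_comb_le (hK : MeasurableSet K) (hKc : Convex ℝ K)
    (f : E → ℝ≥0∞) {s : ℝ} (hs : 1 / 2 ≤ s) (hs1 : s ≤ 1) {y : E}
    (hy : y ∈ K) :
    ∫⁻ x in K, f (s • x + (1 - s) • y) ∂μ ≤ 2 ^ finrank ℝ E * ∫⁻ x in K, f x ∂μ := by
  have hs0 : 0 < s := by linarith
  calc ∫⁻ x in K, f (s • x + (1 - s) • y) ∂μ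
      ≤ ∫⁻ x in K, K.indicator f (s • x + (1 - s) • y) ∂μ := by
        refine setLIntegral_mono' hK fun x hx => ?_
        rw [indicator_of_mem (hKc hx hy hs0.le (by linarith) (by ring))]
    _ ≤ ∫⁻ x, K.indicator f (s • x + (1 - s) • y) ∂μ := setLIntegral_le_lintegral _ _
    _ = ENNReal.ofReal |(s ^ finrank ℝ E)⁻¹| * ∫⁻ x in K, f x ∂μ := by
        rw [lintegral_comp_smul_add _ hs0.ne', lintegral_indicator hK]
    _ ≤ 2 ^ finrank ℝ E * ∫⁻ x in K, f x ∂μ := by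
        gcongr
        rw [← ENNReal.ofReal_ofNat 2, ← ENNReal.ofReal_pow two_pos.le, abs_of_pos (by positivity),
          ← inv_pow]
        exact ENNReal.ofReal_le_ofReal
          (pow_le_pow_left₀ (by positivity) (inv_le_of_inv_le₀ two_pos (by linarith)) _)

/- Whichever of the two coefficients is at least `1 / 2`, one integrates first in the variable
that carries it: the change of variables then costs at most a factor `2 ^ n`. -/
theorem lintegral_lintegral_comp_convex_comb_le (hK : MeasurableSet K)
    (hKc : Convex ℝ K) {f : E → ℝ≥0∞} (hf : Measurable f) {s : ℝ} (hs : s ∈ Icc (0 : ℝ) 1) :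
    ∫⁻ x in K, ∫⁻ y in K, f (s • x + (1 - s) • y) ∂μ ∂μ
      ≤ μ K * (2 ^ finrank ℝ E * ∫⁻ x in K, f x ∂μ) := by
  rw [mul_comm, ← setLIntegral_const]
  rcases le_total (1 / 2) s with h | h
  · have hcomb : Measurable fun z : E × E => f (s • z.1 + (1 - s) • z.2) :=
      hf.comp (by fun_prop)
    rw [lintegral_lintegral_swap hcomb.aemeasurable]
    exact setLIntegral_mono' hK fun y hy => setLIntegral_comp_convex_comb_le μ hK hKc f h hs.2 hy
  · refine setLIntegral_mono' hK fun x hx => ?_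
    simpa [add_comm] using setLIntegral_comp_convex_comb_le μ hK hKc f (s := 1 - s)
      (by linarith) (by linarith [hs.1]) hx

theorem lintegral_lintegral_enorm_sub_rpow_le (hp : 1 ≤ p) (hK : MeasurableSet K)
    (hKc : Convex ℝ K) (hφ : ContDiff ℝ 1 φ) :
    ∫⁻ x in K, ∫⁻ y in K, ‖φ x - φ y‖ₑ ^ (p : ℝ) ∂μ ∂μ
      ≤ Metric.ediam K ^ (p : ℝ) *
        (μ K * (2 ^ finrank ℝ E * ∫⁻ x in K, ‖fderiv ℝ φ x‖ₑ ^ (p : ℝ) ∂μ)) := by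
  set f : E → ℝ≥0∞ := fun x => ‖fderiv ℝ φ x‖ₑ ^ (p : ℝ)
  have hf : Measurable f :=
    ((hφ.continuous_fderiv one_ne_zero).enorm.measurable).pow_const _
  have hcomb : Measurable fun z : (E × E) × ℝ => f (z.2 • z.1.1 + (1 - z.2) • z.1.2) :=
    hf.comp (by fun_prop)
  have hslice : Measurable fun z : E × E =>
      ∫⁻ s in Icc (0 : ℝ) 1, f (s • z.1 + (1 - s) • z.2) := hcomb.lintegral_prod_right'
  calc ∫⁻ x in K, ∫⁻ y in K, ‖φ x - φ y‖ₑ ^ (p : ℝ) ∂μ ∂μ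
      ≤ ∫⁻ x in K, ∫⁻ y in K, Metric.ediam K ^ (p : ℝ) *
          (∫⁻ s in Icc (0 : ℝ) 1, f (s • x + (1 - s) • y)) ∂μ ∂μ := by
        refine setLIntegral_mono' hK fun x hx => setLIntegral_mono' hK fun y hy => ?_
        refine (enorm_sub_rpow_le_lintegral_fderiv hp hφ x y).trans ?_
        gcongr
        rw [← edist_eq_enorm_sub]
        exact Metric.edist_le_ediam_of_mem hx hy
    _ = Metric.ediam K ^ (p : ℝ) *
          ∫⁻ z, (∫⁻ s in Icc (0 : ℝ) 1, f (s • z.1 + (1 - s) • z.2))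
            ∂(μ.restrict K).prod (μ.restrict K) := by
        rw [← lintegral_const_mul _ hslice,
          lintegral_prod _ (hslice.const_mul _).aemeasurable]
    _ = Metric.ediam K ^ (p : ℝ) *
          ∫⁻ s in Icc (0 : ℝ) 1, ∫⁻ x in K, ∫⁻ y in K, f (s • x + (1 - s) • y) ∂μ ∂μ := by
        rw [lintegral_lintegral_swap hcomb.aemeasurable]
        congr! 3 with s
        exact lintegral_prod _ (hf.comp (by fun_prop)).aemeasurable
    _ ≤ Metric.ediam K ^ (p : ℝ) * ∫⁻ _ in Icc (0 : ℝ) 1,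
          μ K * (2 ^ finrank ℝ E * ∫⁻ x in K, f x ∂μ) := by
        gcongr 1
        exact setLIntegral_mono' measurableSet_Icc fun s hs =>
          lintegral_lintegral_comp_convex_comb_le μ hK hKc hf hs
    _ = _ := by simp

theorem eLpNorm_sub_average_le_fderiv (hp : 1 ≤ p) (hK : MeasurableSet K) (hKc : Convex ℝ K)
    (hfin : μ K ≠ ⊤) (hφ : ContDiff ℝ 1 φ) :
    eLpNorm (fun x => φ x - ⨍ y in K, φ y ∂μ) p (μ.restrict K)
      ≤ (2 ^ finrank ℝ E) ^ (p⁻¹ : ℝ) * Metric.ediam K *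
        eLpNorm (fderiv ℝ φ) p (μ.restrict K) := by
  rcases eq_or_ne (μ K) 0 with hzero | hzero
  · simp [Measure.restrict_eq_zero.2 hzero]
  have : NeZero (μ.restrict K) := ⟨by simpa using hzero⟩
  have : IsFiniteMeasure (μ.restrict K) := ⟨by simpa using hfin.lt_top⟩
  have hp0 : p ≠ 0 := (zero_lt_one.trans_le hp).ne'
  have hpos : 0 < (p : ℝ) := by positivity
  have hpt (x : E) : ‖φ x - ⨍ y in K, φ y ∂μ‖ₑ ^ (p : ℝ)
      ≤ (μ K)⁻¹ * ∫⁻ y in K, ‖φ x - φ y‖ₑ ^ (p : ℝ) ∂μ := by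
    have hsm : AEStronglyMeasurable φ ((μ.restrict K univ)⁻¹ • μ.restrict K) :=
      hφ.continuous.aestronglyMeasurable
    calc ‖φ x - ⨍ y in K, φ y ∂μ‖ₑ ^ (p : ℝ)
        ≤ (∫⁻ y, ‖φ y - φ x‖ₑ ∂((μ.restrict K univ)⁻¹ • μ.restrict K)) ^ (p : ℝ) := by
          rw [enorm_sub_rev]
          gcongr
          exact enorm_integral_sub_le_lintegral_enorm_sub hsm _
      _ ≤ ∫⁻ y, ‖φ y - φ x‖ₑ ^ (p : ℝ) ∂((μ.restrict K univ)⁻¹ • μ.restrict K) :=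
          lintegral_rpow_le_lintegral_rpow hp (hsm.sub aestronglyMeasurable_const).enorm
      _ = (μ K)⁻¹ * ∫⁻ y in K, ‖φ x - φ y‖ₑ ^ (p : ℝ) ∂μ := by
          simp [lintegral_smul_measure, enorm_sub_rev]
  rw [← ENNReal.rpow_le_rpow_iff hpos, ENNReal.mul_rpow_of_nonneg _ _ hpos.le,
    ENNReal.mul_rpow_of_nonneg _ _ hpos.le, ENNReal.rpow_inv_rpow hpos.ne',
    eLpNorm_nnreal_pow_eq_lintegral hp0, eLpNorm_nnreal_pow_eq_lintegral hp0]
  calc ∫⁻ x in K, ‖φ x - ⨍ y in K, φ y ∂μ‖ₑ ^ (p : ℝ) ∂μ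
      ≤ ∫⁻ x in K, (μ K)⁻¹ * (∫⁻ y in K, ‖φ x - φ y‖ₑ ^ (p : ℝ) ∂μ) ∂μ := lintegral_mono hpt
    _ = (μ K)⁻¹ * ∫⁻ x in K, ∫⁻ y in K, ‖φ x - φ y‖ₑ ^ (p : ℝ) ∂μ ∂μ :=
        lintegral_const_mul' _ _ (by simpa using hzero)
    _ ≤ (μ K)⁻¹ * (Metric.ediam K ^ (p : ℝ) *
          (μ K * (2 ^ finrank ℝ E * ∫⁻ x in K, ‖fderiv ℝ φ x‖ₑ ^ (p : ℝ) ∂μ))) := by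
        gcongr
        exact lintegral_lintegral_enorm_sub_rpow_le μ hp hK hKc hφ
    _ = (μ K)⁻¹ * μ K * (2 ^ finrank ℝ E * Metric.ediam K ^ (p : ℝ) *
          ∫⁻ x in K, ‖fderiv ℝ φ x‖ₑ ^ (p : ℝ) ∂μ) := by ring
    _ = _ := by rw [ENNReal.inv_mul_cancel hzero hfin, one_mul]

end Poincare

theorem memLp_restrict_of_continuous {X F : Type*} [PseudoMetricSpace X] [ProperSpace X]
    [MeasurableSpace X] [BorelSpace X] {μ : Measure X} [IsFiniteMeasureOnCompacts μ]
    [NormedAddCommGroup F] {f : X → F} (hf : Continuous f) {D : Set X}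
    (hD : Bornology.IsBounded D) (p : ℝ≥0∞) : MemLp f p (μ.restrict D) := by
  obtain ⟨C, hC⟩ := hD.isCompact_closure.exists_bound_of_continuousOn hf.continuousOn
  have : IsFiniteMeasure (μ.restrict (closure D)) :=
    ⟨by simpa using hD.isCompact_closure.measure_lt_top⟩
  have hclosure : MemLp f p (μ.restrict (closure D)) :=
    MemLp.of_bound
      (hf.continuousOn.aestronglyMeasurable_of_isCompact hD.isCompact_closure
        isClosed_closure.measurableSet) C
      ((ae_restrict_iff' isClosed_closure.measurableSet).2 (.of_forall hC))
  exact hclosure.mono_measure (Measure.restrict_mono subset_closure le_rfl)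

theorem tendsto_eLpNorm_of_tendsto_eLpNorm_sub {α ι F : Type*} [MeasurableSpace α]
    {μ : Measure α} [NormedAddCommGroup F] {p : ℝ≥0∞} (hp : 1 ≤ p) {l : Filter ι}
    {f : ι → α → F} {f₀ : α → F} (hf : ∀ i, AEStronglyMeasurable (f i) μ)
    (hf₀ : MemLp f₀ p μ) (hlim : Tendsto (fun i => eLpNorm (fun x => f i x - f₀ x) p μ) l (𝓝 0)) :
    Tendsto (fun i => eLpNorm (f i) p μ) l (𝓝 (eLpNorm f₀ p μ)) := by
  have hlower : Tendsto (fun i => eLpNorm f₀ p μ - eLpNorm (fun x => f i x - f₀ x) p μ) l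
      (𝓝 (eLpNorm f₀ p μ)) := by
    simpa using ENNReal.Tendsto.sub tendsto_const_nhds hlim (.inl hf₀.2.ne)
  have hupper : Tendsto (fun i => eLpNorm (fun x => f i x - f₀ x) p μ + eLpNorm f₀ p μ) l
      (𝓝 (eLpNorm f₀ p μ)) := by
    simpa using hlim.add_const (eLpNorm f₀ p μ)
  refine tendsto_of_tendsto_of_tendsto_of_le_of_le hlower hupper (fun i => ?_) fun i => ?_
  · refine tsub_le_iff_right.2 ?_
    simpa [Pi.sub_def] using eLpNorm_sub_le (hf i) ((hf i).sub hf₀.1) hp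
  · simpa [Pi.add_def, Pi.sub_def] using eLpNorm_add_le ((hf i).sub hf₀.1) hf₀.1 hp

theorem HasH1Gradient.poincare {K : Set Plane} (hK : IsOpen K) (hKb : Bornology.IsBounded K)
    (hKc : Convex ℝ K) (hne : K.Nonempty) {u : Plane → ℝ} {G : Plane → Plane}
    (h : HasH1Gradient K u G) :
    eLpNorm (fun x => u x - ⨍ y in K, u y) 2 (volume.restrict K)
      ≤ 2 * Metric.ediam K * eLpNorm G 2 (volume.restrict K) := by
  have : IsFiniteMeasure (volume.restrict K) := ⟨by simpa using hKb.measure_lt_top⟩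
  obtain ⟨φ, hφ, hφu, hφG⟩ := h.exists_contDiff_approx hK hKc hne
  have hm (n) : MemLp (φ n) 2 (volume.restrict K) :=
    memLp_restrict_of_continuous (hφ n).continuous hKb 2
  have hmean (n x) : (φ n x - ⨍ y in K, φ n y) - (u x - ⨍ y in K, u y)
      = (φ n x - u x) - ⨍ y in K, (φ n y - u y) := by
    simp only [average_eq, Measure.real]
    rw [integral_sub ((hm n).integrable one_le_two) (h.memLp.integrable one_le_two), smul_sub]
    ring
  have hfluct : Tendsto (fun n => eLpNorm (fun x =>
      (φ n x - ⨍ y in K, φ n y) - (u x - ⨍ y in K, u y)) 2 (volume.restrict K)) atTop (𝓝 0) := by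
    simp only [hmean]
    refine tendsto_of_tendsto_of_tendsto_of_le_of_le tendsto_const_nhds
      (by simpa using ENNReal.Tendsto.const_mul (a := 2) hφu (by simp)) (fun _ => zero_le)
      fun n => eLpNorm_sub_average_le one_le_two ((hm n).1.sub h.memLp.1)
  have hgrad (n) : AEStronglyMeasurable (∇ (φ n)) (volume.restrict K) :=
    (continuous_gradient ((hφ n).of_le (mod_cast le_top))).aestronglyMeasurable
  have hsmooth (n) : eLpNorm (fun x => φ n x - ⨍ y in K, φ n y) 2 (volume.restrict K)
      ≤ 2 * Metric.ediam K * eLpNorm (∇ (φ n)) 2 (volume.restrict K) := by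
    have hnorm : eLpNorm (∇ (φ n)) 2 (volume.restrict K)
        = eLpNorm (fderiv ℝ (φ n)) 2 (volume.restrict K) :=
      eLpNorm_congr_norm_ae (.of_forall fun x => norm_gradient _ _)
    have hconst : ((2 : ℝ≥0∞) ^ 2) ^ ((2 : ℝ)⁻¹) = 2 := by
      rw [← ENNReal.rpow_natCast, ← ENNReal.rpow_mul]; norm_num
    rw [hnorm]
    simpa [hconst] using eLpNorm_sub_average_le_fderiv volume (p := 2) one_le_two hK.measurableSet
      hKc hKb.measure_lt_top.ne ((hφ n).of_le (mod_cast le_top))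
  refine le_of_tendsto_of_tendsto' (tendsto_eLpNorm_of_tendsto_eLpNorm_sub one_le_two
    (fun n => (hm n).1.sub aestronglyMeasurable_const) (h.memLp.sub (memLp_const _)) hfluct)
    (ENNReal.Tendsto.const_mul (tendsto_eLpNorm_of_tendsto_eLpNorm_sub one_le_two hgrad
      h.memLp_gradient hφG) (.inr ?_)) hsmooth
  exact ENNReal.mul_ne_top (by simp) hKb.ediam_ne_top

section Traces

variable {D : Set Plane} {u φ ψ g g' : Plane → ℝ} {G w w' : Plane → Plane}

theorem memLp_gradient_restrict (hφ : ContDiff ℝ ∞ φ) (hD : Bornology.IsBounded D) (p : ℝ≥0∞) :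
    MemLp (∇ φ) p (volume.restrict D) :=
  memLp_restrict_of_continuous (continuous_gradient (hφ.of_le (mod_cast le_top))) hD p

theorem IsTestFunction.memLp (hφ : IsTestFunction D φ) (p : ℝ≥0∞) :
    MemLp φ p (volume.restrict D) :=
  (hφ.1.continuous.memLp_of_hasCompactSupport hφ.2.1).restrict D

theorem IsTestFunction.memLp_gradient (hφ : IsTestFunction D φ) (p : ℝ≥0∞) :
    MemLp (∇ φ) p (volume.restrict D) :=
  ((continuous_gradient (hφ.1.of_le (mod_cast le_top))).memLp_of_hasCompactSupport
    (hφ.2.1.of_isClosed_subset (isClosed_tsupport _) (tsupport_gradient_subset φ))).restrict D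

theorem integrable_normalTrace (hw : MemLp w 2 (volume.restrict D))
    (hg : MemLp g 2 (volume.restrict D)) (hφ : MemLp φ 2 (volume.restrict D))
    (hφ' : MemLp (∇ φ) 2 (volume.restrict D)) :
    IntegrableOn (fun x => inner ℝ (w x) (∇ φ x) + g x * φ x) D :=
  (integrable_bilin (innerSL ℝ) hw hφ').add (integrable_bilin (ContinuousLinearMap.mul ℝ ℝ) hg hφ)

theorem integrable_pressureTrace (hu : MemLp u 2 (volume.restrict D))
    (hG : MemLp G 2 (volume.restrict D)) (hφ : MemLp φ 2 (volume.restrict D))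
    (hφ' : MemLp (∇ φ) 2 (volume.restrict D)) :
    IntegrableOn (fun x => u x • ∇ φ x + φ x • G x) D :=
  (integrable_bilin (ContinuousLinearMap.lsmul ℝ ℝ) hu hφ').add
    (integrable_bilin (ContinuousLinearMap.lsmul ℝ ℝ) hφ hG)

theorem normalTrace_eq_add (hw : MemLp w 2 (volume.restrict D))
    (hg : MemLp g 2 (volume.restrict D)) (hφ : MemLp φ 2 (volume.restrict D))
    (hφ' : MemLp (∇ φ) 2 (volume.restrict D)) :
    normalTrace D w g φ = (∫ x in D, inner ℝ (w x) (∇ φ x)) + ∫ x in D, g x * φ x :=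
  integral_add (integrable_bilin (innerSL ℝ) hw hφ')
    (integrable_bilin (ContinuousLinearMap.mul ℝ ℝ) hg hφ)

theorem pressureTrace_eq_add (hu : MemLp u 2 (volume.restrict D))
    (hG : MemLp G 2 (volume.restrict D)) (hφ : MemLp φ 2 (volume.restrict D))
    (hφ' : MemLp (∇ φ) 2 (volume.restrict D)) :
    pressureTrace D u G φ = (∫ x in D, u x • ∇ φ x) + ∫ x in D, φ x • G x :=
  integral_add (integrable_bilin (ContinuousLinearMap.lsmul ℝ ℝ) hu hφ')
    (integrable_bilin (ContinuousLinearMap.lsmul ℝ ℝ) hφ hG)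

theorem normalTrace_eq_univ (hφ : tsupport φ ⊆ D) :
    normalTrace D w g φ = normalTrace univ w g φ := by
  rw [normalTrace, normalTrace, setIntegral_univ]
  exact setIntegral_eq_integral_of_forall_compl_eq_zero fun x hx => by
    have hx' : x ∉ tsupport φ := fun h => hx (hφ h)
    simp [gradient_eq_zero_of_notMem_tsupport hx', image_eq_zero_of_notMem_tsupport hx']

theorem pressureTrace_eq_univ (hφ : tsupport φ ⊆ D) :
    pressureTrace D u G φ = pressureTrace univ u G φ := by
  rw [pressureTrace, pressureTrace, setIntegral_univ]
  exact setIntegral_eq_integral_of_forall_compl_eq_zero fun x hx => by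
    have hx' : x ∉ tsupport φ := fun h => hx (hφ h)
    simp [gradient_eq_zero_of_notMem_tsupport hx', image_eq_zero_of_notMem_tsupport hx']

theorem normalTrace_congr_ae (hw : w =ᵐ[volume.restrict D] w') (hg : g =ᵐ[volume.restrict D] g') :
    normalTrace D w g φ = normalTrace D w' g' φ :=
  integral_congr_ae (by filter_upwards [hw, hg] with x hwx hgx; rw [hwx, hgx])

theorem normalTrace_add (hD : Bornology.IsBounded D) (hw : MemLp w 2 (volume.restrict D))
    (hg : MemLp g 2 (volume.restrict D)) (hφ : ContDiff ℝ ∞ φ) (hψ : ContDiff ℝ ∞ ψ) :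
    normalTrace D w g (fun x => φ x + ψ x) = normalTrace D w g φ + normalTrace D w g ψ := by
  have hint {χ : Plane → ℝ} (hχ : ContDiff ℝ ∞ χ) := integrable_normalTrace hw hg
    (memLp_restrict_of_continuous hχ.continuous hD 2) (memLp_gradient_restrict hχ hD 2)
  rw [normalTrace, normalTrace, normalTrace, ← integral_add (hint hφ) (hint hψ)]
  congr with x
  rw [gradient_fun_add (hφ.differentiable (by simp) x) (hψ.differentiable (by simp) x),
    inner_add_right]
  ring

theorem normalTrace_fun_sub (hw : MemLp w 2 (volume.restrict D))
    (hg : MemLp g 2 (volume.restrict D)) (hw' : MemLp w' 2 (volume.restrict D))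
    (hg' : MemLp g' 2 (volume.restrict D)) (hφ : MemLp φ 2 (volume.restrict D))
    (hφ' : MemLp (∇ φ) 2 (volume.restrict D)) :
    normalTrace D (fun x => w x - w' x) (fun x => g x - g' x) φ
      = normalTrace D w g φ - normalTrace D w' g' φ := by
  rw [normalTrace, normalTrace, normalTrace,
    ← integral_sub (integrable_normalTrace hw hg hφ hφ') (integrable_normalTrace hw' hg' hφ hφ')]
  congr with x
  rw [inner_sub_left]
  ring

theorem pressureTrace_fun_sub {u' : Plane → ℝ} {G' : Plane → Plane}
    (hu : MemLp u 2 (volume.restrict D)) (hG : MemLp G 2 (volume.restrict D))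
    (hu' : MemLp u' 2 (volume.restrict D)) (hG' : MemLp G' 2 (volume.restrict D))
    (hφ : MemLp φ 2 (volume.restrict D)) (hφ' : MemLp (∇ φ) 2 (volume.restrict D)) :
    pressureTrace D (fun x => u x - u' x) (fun x => G x - G' x) φ
      = pressureTrace D u G φ - pressureTrace D u' G' φ := by
  rw [pressureTrace, pressureTrace, pressureTrace, ← integral_sub
    (integrable_pressureTrace hu hG hφ hφ') (integrable_pressureTrace hu' hG' hφ hφ')]
  congr with x : 1
  rw [sub_smul, smul_sub]
  abel

theorem tendsto_normalTrace {ι : Type*} {l : Filter ι} {w : ι → Plane → Plane}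
    {g : ι → Plane → ℝ} {w₀ : Plane → Plane} {g₀ : Plane → ℝ}
    (hw : ∀ᶠ i in l, MemLp (w i) 2 (volume.restrict D))
    (hg : ∀ᶠ i in l, MemLp (g i) 2 (volume.restrict D)) (hw₀ : MemLp w₀ 2 (volume.restrict D))
    (hg₀ : MemLp g₀ 2 (volume.restrict D))
    (hwlim : Tendsto (fun i => eLpNorm (fun x => w i x - w₀ x) 2 (volume.restrict D)) l (𝓝 0))
    (hglim : Tendsto (fun i => eLpNorm (fun x => g i x - g₀ x) 2 (volume.restrict D)) l (𝓝 0))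
    (hφ : MemLp φ 2 (volume.restrict D)) (hφ' : MemLp (∇ φ) 2 (volume.restrict D)) :
    Tendsto (fun i => normalTrace D (w i) (g i) φ) l (𝓝 (normalTrace D w₀ g₀ φ)) := by
  rw [normalTrace_eq_add hw₀ hg₀ hφ hφ']
  refine ((tendsto_integral_bilin (innerSL ℝ) hw hw₀ hφ' hwlim).add
    (tendsto_integral_bilin (ContinuousLinearMap.mul ℝ ℝ) hg hg₀ hφ hglim)).congr' ?_
  filter_upwards [hw, hg] with i hwi hgi using (normalTrace_eq_add hwi hgi hφ hφ').symm

theorem tendsto_pressureTrace {ι : Type*} {l : Filter ι} {u : ι → Plane → ℝ}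
    {G : ι → Plane → Plane} {u₀ : Plane → ℝ} {G₀ : Plane → Plane}
    (hu : ∀ᶠ i in l, MemLp (u i) 2 (volume.restrict D))
    (hG : ∀ᶠ i in l, MemLp (G i) 2 (volume.restrict D)) (hu₀ : MemLp u₀ 2 (volume.restrict D))
    (hG₀ : MemLp G₀ 2 (volume.restrict D))
    (hulim : Tendsto (fun i => eLpNorm (fun x => u i x - u₀ x) 2 (volume.restrict D)) l (𝓝 0))
    (hGlim : Tendsto (fun i => eLpNorm (fun x => G i x - G₀ x) 2 (volume.restrict D)) l (𝓝 0))
    (hφ : MemLp φ 2 (volume.restrict D)) (hφ' : MemLp (∇ φ) 2 (volume.restrict D)) :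
    Tendsto (fun i => pressureTrace D (u i) (G i) φ) l (𝓝 (pressureTrace D u₀ G₀ φ)) := by
  rw [pressureTrace_eq_add hu₀ hG₀ hφ hφ']
  refine ((tendsto_integral_bilin (ContinuousLinearMap.lsmul ℝ ℝ) hu hu₀ hφ' hulim).add
    (tendsto_integral_bilin (ContinuousLinearMap.lsmul ℝ ℝ).flip hG hG₀ hφ hGlim)).congr' ?_
  filter_upwards [hu, hG] with i hui hGi using (pressureTrace_eq_add hui hGi hφ hφ').symm

end Traces

section WeakDerivatives

variable {D D' : Set Plane} {u u' g φ : Plane → ℝ} {G G' w : Plane → Plane}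

theorem hasH1Gradient_iff : HasH1Gradient D u G ↔
    MemLp u 2 (volume.restrict D) ∧ MemLp G 2 (volume.restrict D) ∧
      ∀ φ, IsTestFunction D φ → pressureTrace D u G φ = 0 := by
  refine ⟨fun h => ⟨h.memLp, h.memLp_gradient, fun φ hφ => ?_⟩, fun ⟨hu, hG, h⟩ => ⟨hu, hG, ?_⟩⟩
  · rw [pressureTrace_eq_add h.memLp h.memLp_gradient (hφ.memLp 2) (hφ.memLp_gradient 2),
      h.weak_gradient φ hφ, neg_add_cancel]
  · intro φ hφ
    rw [eq_neg_iff_add_eq_zero,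
      ← pressureTrace_eq_add hu hG (hφ.memLp 2) (hφ.memLp_gradient 2), h φ hφ]

theorem hasWeakDivergence_iff : HasWeakDivergence D w g ↔
    MemLp w 2 (volume.restrict D) ∧ MemLp g 2 (volume.restrict D) ∧
      ∀ φ, IsTestFunction D φ → normalTrace D w g φ = 0 := by
  refine ⟨fun h => ⟨h.memLp, h.memLp_div, fun φ hφ => ?_⟩, fun ⟨hw, hg, h⟩ => ⟨hw, hg, ?_⟩⟩
  · rw [normalTrace_eq_add h.memLp h.memLp_div (hφ.memLp 2) (hφ.memLp_gradient 2),
      h.weak_div φ hφ, neg_add_cancel]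
  · intro φ hφ
    rw [eq_neg_iff_add_eq_zero,
      ← normalTrace_eq_add hw hg (hφ.memLp 2) (hφ.memLp_gradient 2), h φ hφ]

theorem IsTestFunction.mono (hsub : D' ⊆ D) (hφ : IsTestFunction D' φ) : IsTestFunction D φ :=
  ⟨hφ.1, hφ.2.1, hφ.2.2.trans hsub⟩

theorem HasH1Gradient.mono (hsub : D' ⊆ D) (h : HasH1Gradient D u G) : HasH1Gradient D' u G := by
  have hrestrict : volume.restrict D' ≤ volume.restrict D := Measure.restrict_mono hsub le_rfl
  refine hasH1Gradient_iff.2 ⟨h.memLp.mono_measure hrestrict,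
    h.memLp_gradient.mono_measure hrestrict, fun φ hφ => ?_⟩
  rw [pressureTrace_eq_univ hφ.2.2, ← pressureTrace_eq_univ (hφ.2.2.trans hsub)]
  exact (hasH1Gradient_iff.1 h).2.2 φ (hφ.mono hsub)

theorem HasWeakDivergence.mono (hsub : D' ⊆ D) (h : HasWeakDivergence D w g) :
    HasWeakDivergence D' w g := by
  have hrestrict : volume.restrict D' ≤ volume.restrict D := Measure.restrict_mono hsub le_rfl
  refine hasWeakDivergence_iff.2 ⟨h.memLp.mono_measure hrestrict,
    h.memLp_div.mono_measure hrestrict, fun φ hφ => ?_⟩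
  rw [normalTrace_eq_univ hφ.2.2, ← normalTrace_eq_univ (hφ.2.2.trans hsub)]
  exact (hasWeakDivergence_iff.1 h).2.2 φ (hφ.mono hsub)

theorem HasH1Gradient.sub (h : HasH1Gradient D u G) (h' : HasH1Gradient D u' G') :
    HasH1Gradient D (fun x => u x - u' x) (fun x => G x - G' x) := by
  refine hasH1Gradient_iff.2 ⟨h.memLp.sub h'.memLp, h.memLp_gradient.sub h'.memLp_gradient,
    fun φ hφ => ?_⟩
  rw [pressureTrace_fun_sub h.memLp h.memLp_gradient h'.memLp h'.memLp_gradient (hφ.memLp 2)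
    (hφ.memLp_gradient 2), (hasH1Gradient_iff.1 h).2.2 φ hφ, (hasH1Gradient_iff.1 h').2.2 φ hφ,
    sub_zero]

theorem integral_gradient_eq_zero {E : Type*} [NormedAddCommGroup E] [InnerProductSpace ℝ E]
    [FiniteDimensional ℝ E] [MeasurableSpace E] [BorelSpace E] (μ : Measure E)
    [μ.IsAddHaarMeasure] {φ : E → ℝ} (hφ : ContDiff ℝ 1 φ) (hsupp : HasCompactSupport φ) :
    ∫ x, ∇ φ x ∂μ = 0 := by
  have hint : Integrable (∇ φ) μ := (continuous_gradient hφ).integrable_of_hasCompactSupport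
    (hsupp.of_isClosed_subset (isClosed_tsupport _) (tsupport_gradient_subset φ))
  refine integral_eq_zero_of_forall_integral_inner_eq_zero (𝕜 := ℝ) _ hint fun c => ?_
  have hinner (x : E) : inner ℝ c (∇ φ x) = 1 * fderiv ℝ φ x c := by
    rw [real_inner_comm, inner_gradient_left, one_mul]
  have hint' : Integrable (fun x => 1 * fderiv ℝ φ x c) μ := by
    simpa only [hinner] using hint.const_inner (𝕜 := ℝ) c
  simp_rw [hinner]
  rw [integral_mul_fderiv_eq_neg_fderiv_mul_of_integrable (f := fun _ => (1 : ℝ)) (by simp) hint'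
    (by simpa using hφ.continuous.integrable_of_hasCompactSupport hsupp)
    (fun _ _ => differentiableAt_const _) fun x _ => hφ.differentiable one_ne_zero x]
  simp

theorem HasH1Gradient.const (hD : Bornology.IsBounded D) (c : ℝ) :
    HasH1Gradient D (fun _ => c) (fun _ => 0) := by
  refine hasH1Gradient_iff.2 ⟨memLp_restrict_of_continuous continuous_const hD 2,
    memLp_restrict_of_continuous continuous_const hD 2, fun φ hφ => ?_⟩
  rw [pressureTrace_eq_univ hφ.2.2, pressureTrace]
  simp [integral_smul, integral_gradient_eq_zero volume (hφ.1.of_le (mod_cast le_top)) hφ.2.1]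

theorem HasH1Gradient.of_tendsto {ι : Type*} {l : Filter ι} [l.NeBot] {u : ι → Plane → ℝ}
    {G : ι → Plane → Plane} {u₀ : Plane → ℝ} {G₀ : Plane → Plane}
    (h : ∀ᶠ i in l, HasH1Gradient D (u i) (G i))
    (hu₀ : MemLp u₀ 2 (volume.restrict D)) (hG₀ : MemLp G₀ 2 (volume.restrict D))
    (hu : Tendsto (fun i => eLpNorm (fun x => u i x - u₀ x) 2 (volume.restrict D)) l (𝓝 0))
    (hG : Tendsto (fun i => eLpNorm (fun x => G i x - G₀ x) 2 (volume.restrict D)) l (𝓝 0)) :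
    HasH1Gradient D u₀ G₀ := by
  refine hasH1Gradient_iff.2 ⟨hu₀, hG₀, fun φ hφ => ?_⟩
  have hlim := tendsto_pressureTrace (h.mono fun i hi => hi.memLp)
    (h.mono fun i hi => hi.memLp_gradient) hu₀ hG₀ hu hG (hφ.memLp 2) (hφ.memLp_gradient 2)
  refine tendsto_nhds_unique hlim (tendsto_const_nhds.congr' (h.mono fun i hi => ?_))
  exact ((hasH1Gradient_iff.1 hi).2.2 φ hφ).symm

theorem HasH1Gradient.integral_inner_add_eq_zero (hD : IsOpen D) (hDb : Bornology.IsBounded D)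
    (hDc : Convex ℝ D) (hne : D.Nonempty) (h : HasH1Gradient D u G)
    (hw : MemLp w 2 (volume.restrict D)) (hg : MemLp g 2 (volume.restrict D))
    (hzero : ∀ φ : Plane → ℝ, ContDiff ℝ ∞ φ → normalTrace D w g φ = 0) :
    (∫ x in D, inner ℝ (w x) (G x)) + ∫ x in D, g x * u x = 0 := by
  obtain ⟨φ, hφ, hφu, hφG⟩ := h.exists_contDiff_approx hD hDc hne
  have hm (n) : MemLp (φ n) 2 (volume.restrict D) :=
    memLp_restrict_of_continuous (hφ n).continuous hDb 2
  have hm' (n) := memLp_gradient_restrict (hφ n) hDb 2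
  have hlim := (tendsto_integral_bilin (innerSL ℝ : Plane →L[ℝ] Plane →L[ℝ] ℝ).flip
    (.of_forall hm') h.memLp_gradient hw hφG).add
    (tendsto_integral_bilin (ContinuousLinearMap.mul ℝ ℝ).flip (.of_forall hm) h.memLp hg hφu)
  refine tendsto_nhds_unique hlim (tendsto_const_nhds.congr fun n => ?_)
  rw [← hzero _ (hφ n)]
  exact normalTrace_eq_add hw hg (hm n) (hm' n)

end WeakDerivatives

section PointCapacity

open Module

theorem eLpNorm_gradient_comp_smul_add {E : Type*} [NormedAddCommGroup E] [InnerProductSpace ℝ E]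
    [FiniteDimensional ℝ E] [Nontrivial E] [MeasurableSpace E] [BorelSpace E] (μ : Measure E)
    [μ.IsAddHaarMeasure] (φ : E → ℝ) {s : ℝ} (hs : s ≠ 0) (c : E) :
    eLpNorm (∇ (fun x => φ (s • x + c))) (finrank ℝ E) μ = eLpNorm (∇ φ) (finrank ℝ E) μ := by
  have hn : finrank ℝ E ≠ 0 := finrank_pos.ne'
  have hscale : ‖s‖ₑ * ENNReal.ofReal |(s ^ finrank ℝ E)⁻¹| ^ ((finrank ℝ E : ℝ)⁻¹) = 1 := by
    rw [abs_inv, abs_pow, ← inv_pow, ENNReal.ofReal_pow (by positivity),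
      ENNReal.pow_rpow_inv_natCast hn, ← ofReal_norm, Real.norm_eq_abs,
      ← ENNReal.ofReal_mul (abs_nonneg s), mul_inv_cancel₀ (abs_ne_zero.2 hs), ENNReal.ofReal_one]
  have hgrad : ∇ (fun x => φ (s • x + c)) = fun x => s • ∇ φ (s • x + c) :=
    funext fun x => gradient_comp_smul_add φ s c x
  rw [hgrad]
  refine (eLpNorm_const_smul s _ _ μ).trans ?_
  rw [eLpNorm_comp_smul_add (∇ φ) _ hs c, one_div, ENNReal.toReal_inv, ENNReal.toReal_natCast,
    ← mul_assoc, hscale, one_mul]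

theorem tendsto_eLpNorm_indicator_closedBall {X F : Type*} [MetricSpace X] [ProperSpace X]
    [MeasurableSpace X] [BorelSpace X] {μ : Measure X} [IsFiniteMeasureOnCompacts μ]
    [NullSingletonClass μ] [NormedAddCommGroup F] {p : NNReal} (hp : p ≠ 0) {f : X → F}
    (hf : MemLp f p μ) (z : X) :
    Tendsto (fun r => eLpNorm ((Metric.closedBall z r).indicator f) p μ) (𝓝[>] 0) (𝓝 0) := by
  have hball : Tendsto (fun r => μ (Metric.closedBall z r)) (𝓝[>] 0) (𝓝 0) := by
    have hthick := (tendsto_measure_cthickening_of_isCompact (μ := μ)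
      (isCompact_singleton (x := z))).mono_left (nhdsWithin_le_nhds (s := Ioi 0))
    rw [measure_singleton] at hthick
    refine hthick.congr' (eventually_nhdsWithin_of_forall fun r hr => ?_)
    rw [Metric.cthickening_singleton z (le_of_lt hr)]
  have hfin : ∫⁻ x, ‖f x‖ₑ ^ (p : ℝ) ∂μ ≠ ⊤ := by
    rw [← eLpNorm_nnreal_pow_eq_lintegral hp]
    exact ENNReal.rpow_ne_top_of_nonneg p.coe_nonneg hf.2.ne
  have hlim := (ENNReal.continuous_rpow_const (y := (p : ℝ)⁻¹)).tendsto 0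
    |>.comp (tendsto_setLIntegral_zero hfin hball)
  rw [ENNReal.zero_rpow_of_pos (by positivity)] at hlim
  refine hlim.congr fun r => ?_
  rw [eLpNorm_indicator_eq_eLpNorm_restrict Metric.isClosed_closedBall.measurableSet,
    eLpNorm_nnreal_eq_lintegral hp, one_div]
  rfl

/- The Dirichlet energy is scale invariant in the plane, so shrinking a fixed bump function towards
`z` does not increase it. -/
theorem exists_cutoff_eLpNorm_gradient_le (z : Plane) :
    ∃ B : ℝ≥0∞, B ≠ ⊤ ∧ ∀ r > 0, ∃ η : Plane → ℝ, ContDiff ℝ ∞ η ∧ (∀ x, ‖η x‖ ≤ 1) ∧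
      η =ᶠ[𝓝 z] 1 ∧ tsupport η ⊆ Metric.closedBall z r ∧ eLpNorm (∇ η) 2 volume ≤ B := by
  let b : ContDiffBump (0 : Plane) := ⟨1 / 2, 1, by norm_num, by norm_num⟩
  have hb : ContDiff ℝ ∞ b := b.contDiff
  have hbcont : Continuous (∇ b) := continuous_gradient (hb.of_le (mod_cast le_top))
  have hbsupp : HasCompactSupport (∇ b) :=
    b.hasCompactSupport.of_isClosed_subset (isClosed_tsupport _) (tsupport_gradient_subset b)
  refine ⟨eLpNorm (∇ b) 2 volume, (hbcont.memLp_of_hasCompactSupport hbsupp).2.ne, fun r hr =>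
    ⟨fun x => b (r⁻¹ • x + -(r⁻¹ • z)), hb.comp (by fun_prop), fun x => ?_, ?_, ?_, ?_⟩⟩
  · rw [Real.norm_of_nonneg b.nonneg]
    exact b.le_one
  · have hlim : Tendsto (fun x : Plane => r⁻¹ • x + -(r⁻¹ • z)) (𝓝 z) (𝓝 0) := by
      have : Continuous fun x : Plane => r⁻¹ • x + -(r⁻¹ • z) := by fun_prop
      simpa using this.tendsto z
    exact hlim.eventually b.eventuallyEq_one
  · refine closure_minimal (fun x hx => ?_) Metric.isClosed_closedBall
    have hx' : r⁻¹ • x + -(r⁻¹ • z) ∈ Metric.ball (0 : Plane) 1 := b.support_eq ▸ hx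
    rw [← sub_eq_add_neg, ← smul_sub, mem_ball_zero_iff, norm_smul, norm_inv,
      Real.norm_of_nonneg hr.le, inv_mul_lt_one₀ hr] at hx'
    exact mem_closedBall_iff_norm.2 hx'.le
  · simpa using (eLpNorm_gradient_comp_smul_add volume b (inv_ne_zero hr.ne') (-(r⁻¹ • z))).le

theorem eLpNorm_gradient_mul_le {E : Type*} [NormedAddCommGroup E] [InnerProductSpace ℝ E]
    [FiniteDimensional ℝ E] [MeasurableSpace E] [BorelSpace E] {μ : Measure E} {p : ℝ≥0∞}
    (hp : 1 ≤ p) {η φ : E → ℝ} (hη : ContDiff ℝ 1 η) (hφ : ContDiff ℝ 1 φ)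
    (hη1 : ∀ᵐ x ∂μ, ‖η x‖ ≤ 1) {M : ℝ} (hM : ∀ᵐ x ∂μ, ‖φ x‖ ≤ M) :
    eLpNorm (∇ (fun x => η x * φ x)) p μ
      ≤ eLpNorm (∇ φ) p μ + ENNReal.ofReal M * eLpNorm (∇ η) p μ := by
  have hgrad : ∇ (fun x => η x * φ x) = η • ∇ φ + φ • ∇ η :=
    funext fun x => gradient_fun_mul (hη.differentiable one_ne_zero x)
      (hφ.differentiable one_ne_zero x)
  rw [hgrad]
  refine (eLpNorm_add_le (hη.continuous.smul (continuous_gradient hφ)).aestronglyMeasurable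
    (hφ.continuous.smul (continuous_gradient hη)).aestronglyMeasurable hp).trans (add_le_add ?_ ?_)
  · refine eLpNorm_mono_ae (hη1.mono fun x hx => ?_)
    rw [Pi.smul_apply', norm_smul]
    exact mul_le_of_le_one_left (norm_nonneg _) hx
  · refine eLpNorm_le_mul_eLpNorm_of_ae_le_mul (hM.mono fun x hx => ?_) p
    rw [Pi.smul_apply', norm_smul]
    gcongr

theorem exists_localization {D : Set Plane} (hD : Bornology.IsBounded D) {φ : Plane → ℝ}
    (hφ : ContDiff ℝ ∞ φ) (z : Plane) :
    ∃ B : ℝ≥0∞, B ≠ ⊤ ∧ ∀ r > 0, ∃ ψ : Plane → ℝ, ContDiff ℝ ∞ ψ ∧ ψ =ᶠ[𝓝 z] φ ∧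
      tsupport ψ ⊆ tsupport φ ∧ tsupport ψ ⊆ Metric.closedBall z r ∧
      eLpNorm ψ 2 (volume.restrict D) ≤ B ∧ eLpNorm (∇ ψ) 2 (volume.restrict D) ≤ B := by
  obtain ⟨A, hA, hcutoff⟩ := exists_cutoff_eLpNorm_gradient_le z
  obtain ⟨M, hM⟩ := hD.isCompact_closure.exists_bound_of_continuousOn hφ.continuous.continuousOn
  have hMD : ∀ᵐ x ∂volume.restrict D, ‖φ x‖ ≤ M :=
    (ae_restrict_of_ae_restrict_of_subset subset_closure
      (ae_restrict_mem isClosed_closure.measurableSet)).mono hM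
  have hφ₂ := (memLp_restrict_of_continuous (μ := volume) hφ.continuous hD 2).2.ne
  have hφ₂' := (memLp_gradient_restrict hφ hD 2).2.ne
  refine ⟨eLpNorm φ 2 (volume.restrict D) + (eLpNorm (∇ φ) 2 (volume.restrict D)
    + ENNReal.ofReal M * A), by finiteness, fun r hr => ?_⟩
  obtain ⟨η, hη, hη1, hηz, hηsupp, hηA⟩ := hcutoff r hr
  refine ⟨fun x => η x * φ x, hη.mul hφ, ?_, tsupport_mul_subset_right,
    tsupport_mul_subset_left.trans hηsupp, ?_, ?_⟩
  · filter_upwards [hηz] with x hx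
    simp [hx]
  · refine (eLpNorm_mono fun x => ?_).trans le_self_add
    rw [norm_mul]
    exact mul_le_of_le_one_left (norm_nonneg _) (hη1 x)
  · refine (eLpNorm_gradient_mul_le one_le_two (hη.of_le (mod_cast le_top))
      (hφ.of_le (mod_cast le_top)) (.of_forall hη1) hMD).trans (le_trans ?_ le_add_self)
    gcongr
    exact (eLpNorm_mono_measure _ Measure.restrict_le_self).trans hηA

variable {D : Set Plane} {w : Plane → Plane} {g φ : Plane → ℝ}

theorem enorm_normalTrace_le (hw : MemLp w 2 (volume.restrict D))
    (hg : MemLp g 2 (volume.restrict D)) (hφ : MemLp φ 2 (volume.restrict D))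
    (hφ' : MemLp (∇ φ) 2 (volume.restrict D)) :
    ‖normalTrace D w g φ‖ₑ
      ≤ eLpNorm w 2 (volume.restrict D) * eLpNorm (∇ φ) 2 (volume.restrict D)
        + eLpNorm g 2 (volume.restrict D) * eLpNorm φ 2 (volume.restrict D) := by
  rw [normalTrace_eq_add hw hg hφ hφ']
  refine (enorm_add_le _ _).trans (add_le_add ?_ ?_)
  · have hnorm : ‖(innerSL ℝ : Plane →L[ℝ] Plane →L[ℝ] ℝ)‖ₑ ≤ 1 := by
      rw [← ofReal_norm]
      exact ENNReal.ofReal_le_one.2 (norm_innerSL_le ℝ)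
    refine (enorm_integral_bilin_le (p := 2) (q := 2) (innerSL ℝ) hw.1 hφ'.1).trans ?_
    simpa [mul_assoc] using mul_le_mul_left hnorm _
  · refine (enorm_integral_bilin_le (p := 2) (q := 2) (ContinuousLinearMap.mul ℝ ℝ)
      hg.1 hφ.1).trans ?_
    simp

theorem normalTrace_indicator {S : Set Plane} (hφ : tsupport φ ⊆ S) :
    normalTrace D (S.indicator w) (S.indicator g) φ = normalTrace D w g φ := by
  rw [normalTrace, normalTrace]
  congr with x
  by_cases hx : x ∈ S
  · simp [hx]
  · have hx' : x ∉ tsupport φ := fun h => hx (hφ h)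
    simp [gradient_eq_zero_of_notMem_tsupport hx', image_eq_zero_of_notMem_tsupport hx']

theorem normalTrace_eq_zero_of_forall_eventuallyEq_zero (hD : Bornology.IsBounded D)
    (hw : MemLp w 2 (volume.restrict D)) (hg : MemLp g 2 (volume.restrict D))
    (hφ : ContDiff ℝ ∞ φ) (z : Plane)
    (h : ∀ ψ : Plane → ℝ, ContDiff ℝ ∞ ψ → ψ =ᶠ[𝓝 z] 0 → tsupport ψ ⊆ tsupport φ →
      normalTrace D w g ψ = 0) : normalTrace D w g φ = 0 := by
  obtain ⟨B, hB, hloc⟩ := exists_localization hD hφ z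
  have hle : ∀ᶠ r in 𝓝[>] (0 : ℝ), ‖normalTrace D w g φ‖ₑ
      ≤ eLpNorm ((Metric.closedBall z r).indicator w) 2 (volume.restrict D) * B
        + eLpNorm ((Metric.closedBall z r).indicator g) 2 (volume.restrict D) * B := by
    refine eventually_nhdsWithin_of_forall fun r hr => ?_
    obtain ⟨ψ, hψ, hψz, hψsupp, hψr, hψB, hψB'⟩ := hloc r hr
    have hball := Metric.isClosed_closedBall (x := z) (ε := r) |>.measurableSet
    have hdiff : normalTrace D w g (fun x => φ x - ψ x) = 0 := by
      refine h _ (hφ.sub hψ) (hψz.mono fun x hx => ?_) ((tsupport_sub _ _).trans ?_)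
      · simp [hx]
      · exact union_subset le_rfl hψsupp
    have hsplit := normalTrace_add hD hw hg (hφ.sub hψ) hψ
    simp only [sub_add_cancel, hdiff, zero_add] at hsplit
    rw [hsplit, ← normalTrace_indicator hψr]
    refine (enorm_normalTrace_le (hw.indicator hball) (hg.indicator hball)
      (memLp_restrict_of_continuous hψ.continuous hD 2) (memLp_gradient_restrict hψ hD 2)).trans ?_
    gcongr
  have hlim := (ENNReal.Tendsto.mul_const (b := B)
    (tendsto_eLpNorm_indicator_closedBall two_ne_zero hw z) (.inr hB)).add
    (ENNReal.Tendsto.mul_const (b := B)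
      (tendsto_eLpNorm_indicator_closedBall two_ne_zero hg z) (.inr hB))
  rw [zero_mul, add_zero] at hlim
  simpa using ge_of_tendsto hlim hle

theorem normalTrace_eq_zero_of_finite (hD : Bornology.IsBounded D)
    (hw : MemLp w 2 (volume.restrict D)) (hg : MemLp g 2 (volume.restrict D)) {F : Set Plane}
    (hF : F.Finite)
    (h : ∀ φ : Plane → ℝ, ContDiff ℝ ∞ φ → Disjoint (tsupport φ) F → normalTrace D w g φ = 0)
    (hφ : ContDiff ℝ ∞ φ) : normalTrace D w g φ = 0 := by
  induction F, hF using Set.Finite.induction_on generalizing φ with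
  | empty => exact h φ hφ (disjoint_empty _)
  | @insert z F _ _ ih =>
    refine ih (fun φ hφ hdisj => ?_) hφ
    refine normalTrace_eq_zero_of_forall_eventuallyEq_zero hD hw hg hφ z fun ψ hψ hψz hsub => ?_
    refine h ψ hψ (disjoint_insert_right.2 ⟨notMem_tsupport_iff_eventuallyEq.2 hψz, ?_⟩)
    exact hdisj.mono_left hsub

end PointCapacity

section Cutoffs

variable {U V : Set Plane} {w : Plane → Plane} {g φ ψ : Plane → ℝ}

theorem normalTrace_congr (hU : IsOpen U) (h : EqOn φ ψ U) :
    normalTrace U w g φ = normalTrace U w g ψ := by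
  refine setIntegral_congr_fun hU.measurableSet fun x hx => ?_
  have hnhds : φ =ᶠ[𝓝 x] ψ := h.eventuallyEq_of_mem (hU.mem_nhds hx)
  simp only [hnhds.gradient_eq, h hx]

theorem exists_isTestFunction_add {C : Set Plane} (hU : IsOpen U) (hφ : ContDiff ℝ ∞ φ)
    (hcompact : IsCompact (tsupport φ ∩ C)) (hsub : tsupport φ ∩ C ⊆ U) :
    ∃ φ₁ φ₂ : Plane → ℝ, IsTestFunction U φ₁ ∧ ContDiff ℝ ∞ φ₂ ∧ Disjoint (tsupport φ₂) C ∧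
      φ = fun x => φ₁ x + φ₂ x := by
  obtain ⟨Q, hQ, hCQ, hQU⟩ := exists_compact_between hcompact hU hsub
  obtain ⟨χ, hχ1, hχ0, -⟩ := exists_contMDiffMap_one_nhds_of_subset_interior (n := (⊤ : ℕ∞))
    (modelWithCornersSelf ℝ Plane) hcompact.isClosed hCQ
  have hχ : ContDiff ℝ ∞ χ := χ.contMDiff.contDiff
  have hχQ : tsupport χ ⊆ Q :=
    closure_minimal (fun x hx => by_contra fun hxQ => hx (hχ0 x hxQ)) hQ.isClosed
  have hχc : HasCompactSupport χ := hQ.of_isClosed_subset (isClosed_tsupport _) hχQ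
  refine ⟨fun x => χ x * φ x, fun x => (1 - χ x) * φ x,
    ⟨hχ.mul hφ, hχc.mul_right, (tsupport_mul_subset_left.trans hχQ).trans hQU⟩,
    (contDiff_const.sub hχ).mul hφ, disjoint_left.2 fun x hx hxC => ?_, funext fun x => by ring⟩
  have hxφ : x ∈ tsupport φ ∩ C := ⟨tsupport_mul_subset_right hx, hxC⟩
  refine notMem_tsupport_iff_eventuallyEq.2 ?_ hx
  filter_upwards [hχ1.filter_mono (nhds_le_nhdsSet hxφ)] with y hy
  simp [hy]

theorem exists_contDiff_eqOn_eqOn_zero (hφ : ContDiff ℝ ∞ φ)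
    (hdisj : Disjoint (tsupport φ) (closure U ∩ closure V)) :
    ∃ ψ : Plane → ℝ, ContDiff ℝ ∞ ψ ∧ EqOn ψ φ U ∧ EqOn ψ 0 V := by
  have hclosed (S : Set Plane) : IsClosed (tsupport φ ∩ closure S) :=
    (isClosed_tsupport φ).inter isClosed_closure
  obtain ⟨χ, hχ0, hχ1, -⟩ := exists_contMDiffMap_zero_one_of_isClosed (n := (⊤ : ℕ∞))
    (modelWithCornersSelf ℝ Plane) (hclosed V) (hclosed U)
    (disjoint_left.2 fun x hxV hxU => disjoint_left.1 hdisj hxU.1 ⟨hxU.2, hxV.2⟩)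
  refine ⟨fun x => χ x * φ x, χ.contMDiff.contDiff.mul hφ, fun x hx => ?_, fun x hx => ?_⟩ <;>
    by_cases hxφ : x ∈ tsupport φ
  · simp [hχ1 ⟨hxφ, subset_closure hx⟩]
  · simp [image_eq_zero_of_notMem_tsupport hxφ]
  · simp [hχ0 ⟨hxφ, subset_closure hx⟩]
  · simp [image_eq_zero_of_notMem_tsupport hxφ]

end Cutoffs

namespace MFProblem

variable (P : MFProblem)

section Geometry

theorem isOpen_Km : IsOpen P.Km := P.isOpen_K.sdiff isClosed_closure

theorem Km_subset : P.Km ⊆ P.K := sdiff_subset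

theorem disjoint_Km_Kf : Disjoint P.Km P.Kf :=
  disjoint_left.2 fun _ hx hx' => hx.2 (subset_closure hx')

theorem K_nonempty : P.K.Nonempty := P.Kf_nonempty.mono P.Kf_subset

theorem interface_subset : P.interface ⊆ P.K := inter_subset_right

theorem K_subset_union : P.K ⊆ P.Km ∪ P.Kf ∪ P.interface := by
  intro x hx
  by_cases hcl : x ∈ closure P.Kf
  · by_cases hxf : x ∈ P.Kf
    · exact .inl (.inr hxf)
    · exact .inr ⟨⟨hcl, by rwa [P.isOpen_Kf.interior_eq]⟩, hx⟩
  · exact .inl (.inl ⟨hx, hcl⟩)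

theorem closure_Km_inter_closure_Kf_subset :
    closure P.Km ∩ closure P.Kf ⊆ closure P.interface := by
  rintro x ⟨hxm, hxf⟩
  by_contra hx
  obtain ⟨r, hr, hball⟩ := Metric.isOpen_iff.1 isClosed_closure.isOpen_compl x hx
  have hconn : IsPreconnected (Metric.ball x r ∩ P.K) :=
    ((convex_ball x r).inter P.convex_K).isPreconnected
  obtain ⟨y, hy, hyr⟩ := Metric.mem_closure_iff.1 hxm r hr
  obtain ⟨z, hz, hzr⟩ := Metric.mem_closure_iff.1 hxf r hr
  have hcover : Metric.ball x r ∩ P.K ⊆ P.Km ∪ P.Kf := fun v hv =>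
    (P.K_subset_union hv.2).resolve_right fun hvI => hball hv.1 (subset_closure hvI)
  obtain ⟨v, -, hvm, hvf⟩ := hconn P.Km P.Kf P.isOpen_Km P.isOpen_Kf hcover
    ⟨y, ⟨Metric.mem_ball'.2 hyr, P.Km_subset hy⟩, hy⟩
    ⟨z, ⟨Metric.mem_ball'.2 hzr, P.Kf_subset hz⟩, hz⟩
  exact disjoint_left.1 P.disjoint_Km_Kf hvm hvf

end Geometry

section Measure

theorem isFiniteMeasure_restrict {D : Set Plane} (hD : D ⊆ P.K) :
    IsFiniteMeasure (volume.restrict D) :=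
  ⟨by simpa using (P.isBounded_K.subset hD).measure_lt_top⟩

instance : IsFiniteMeasure (volume.restrict P.K) := P.isFiniteMeasure_restrict le_rfl

instance : IsFiniteMeasure (volume.restrict P.Km) := P.isFiniteMeasure_restrict P.Km_subset

instance : IsFiniteMeasure (volume.restrict P.Kf) := P.isFiniteMeasure_restrict P.Kf_subset

theorem neZero_restrict {D : Set Plane} (hD : IsOpen D) (hne : D.Nonempty) :
    NeZero (volume.restrict D) :=
  ⟨Measure.restrict_eq_zero.not.2 (hD.measure_pos volume hne).ne'⟩

instance : NeZero (volume.restrict P.K) := neZero_restrict P.isOpen_K P.K_nonempty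

instance : NeZero (volume.restrict P.Km) := neZero_restrict P.isOpen_Km P.Km_nonempty

instance : NeZero (volume.restrict P.Kf) := neZero_restrict P.isOpen_Kf P.Kf_nonempty

theorem volume_real_Km_pos : 0 < volume.real P.Km := by
  simpa using measureReal_univ_pos (μ := volume.restrict P.Km)

theorem restrict_K : volume.restrict P.K = volume.restrict P.Km + volume.restrict P.Kf := by
  rw [← Measure.restrict_union P.disjoint_Km_Kf P.isOpen_Kf.measurableSet]
  refine Measure.restrict_congr_set (ae_eq_set.2 ⟨?_, ?_⟩)
  · exact measure_mono_null (sdiff_subset_iff.2 P.K_subset_union) P.interface_null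
  · rw [sdiff_eq_empty.2 (union_subset P.Km_subset P.Kf_subset), measure_empty]

theorem ae_restrict_K_iff {p : Plane → Prop} : (∀ᵐ x ∂volume.restrict P.K, p x) ↔
    (∀ᵐ x ∂volume.restrict P.Km, p x) ∧ ∀ᵐ x ∂volume.restrict P.Kf, p x := by
  rw [restrict_K, ae_add_measure_iff]

variable {E : Type*} [NormedAddCommGroup E] {f : Plane → E} {p : ℝ≥0∞}

theorem memLp_restrict_K (hp : 1 ≤ p) (hm : MemLp f p (volume.restrict P.Km))
    (hf : MemLp f p (volume.restrict P.Kf)) : MemLp f p (volume.restrict P.K) :=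
  P.restrict_K ▸ memLp_add_measure hp hm hf

theorem setIntegral_K [NormedSpace ℝ E] (h : IntegrableOn f P.K) :
    ∫ x in P.K, f x = (∫ x in P.Km, f x) + ∫ x in P.Kf, f x := by
  rw [restrict_K]
  exact integral_add_measure (h.mono_set P.Km_subset) (h.mono_set P.Kf_subset)

end Measure

section Gluing

variable {u g φ : Plane → ℝ} {w G : Plane → Plane}

theorem normalTrace_K (hw : MemLp w 2 (volume.restrict P.K))
    (hg : MemLp g 2 (volume.restrict P.K)) (hφ : ContDiff ℝ ∞ φ) :
    normalTrace P.K w g φ = normalTrace P.Km w g φ + normalTrace P.Kf w g φ :=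
  P.setIntegral_K (integrable_normalTrace hw hg
    (memLp_restrict_of_continuous hφ.continuous P.isBounded_K 2)
    (memLp_gradient_restrict hφ P.isBounded_K 2))

theorem pressureTrace_K (hu : MemLp u 2 (volume.restrict P.K))
    (hG : MemLp G 2 (volume.restrict P.K)) (hφ : ContDiff ℝ ∞ φ) :
    pressureTrace P.K u G φ = pressureTrace P.Km u G φ + pressureTrace P.Kf u G φ :=
  P.setIntegral_K (integrable_pressureTrace hu hG
    (memLp_restrict_of_continuous hφ.continuous P.isBounded_K 2)
    (memLp_gradient_restrict hφ P.isBounded_K 2))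

theorem hasH1Gradient_K_iff : HasH1Gradient P.K u G ↔
    HasH1Gradient P.Km u G ∧ HasH1Gradient P.Kf u G ∧ ∀ φ, IsTestFunction P.K φ →
      pressureTrace P.Km u G φ + pressureTrace P.Kf u G φ = 0 := by
  refine ⟨fun h => ⟨h.mono P.Km_subset, h.mono P.Kf_subset, fun φ hφ => ?_⟩, ?_⟩
  · rw [← P.pressureTrace_K h.memLp h.memLp_gradient hφ.1, (hasH1Gradient_iff.1 h).2.2 φ hφ]
  · rintro ⟨hm, hf, htrace⟩
    have hu := P.memLp_restrict_K one_le_two hm.memLp hf.memLp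
    have hG := P.memLp_restrict_K one_le_two hm.memLp_gradient hf.memLp_gradient
    refine hasH1Gradient_iff.2 ⟨hu, hG, fun φ hφ => ?_⟩
    rw [P.pressureTrace_K hu hG hφ.1, htrace φ hφ]

theorem normalTrace_K_eq_zero (hw : MemLp w 2 (volume.restrict P.K))
    (hg : MemLp g 2 (volume.restrict P.K))
    (hinterface : ∀ φ, IsTestFunction P.K φ → normalTrace P.K w g φ = 0)
    (houter : ∀ φ : Plane → ℝ, ContDiff ℝ ∞ φ → Disjoint (tsupport φ) (closure P.interface) →
      normalTrace P.K w g φ = 0)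
    (hφ : ContDiff ℝ ∞ φ) : normalTrace P.K w g φ = 0 := by
  refine normalTrace_eq_zero_of_finite P.isBounded_K hw hg P.interface_ends (fun φ hφ hd => ?_) hφ
  have hcompact : IsCompact (tsupport φ ∩ closure P.interface) :=
    (P.isBounded_K.subset P.interface_subset).isCompact_closure.inter_left (isClosed_tsupport φ)
  have hsub : tsupport φ ∩ closure P.interface ⊆ P.K := fun x hx => by_contra fun hxK =>
    disjoint_left.1 hd hx.1 ⟨hx.2, closure_mono P.interface_subset hx.2,
      by rwa [P.isOpen_K.interior_eq]⟩
  obtain ⟨φ₁, φ₂, hφ₁, hφ₂, hdisj, rfl⟩ := exists_isTestFunction_add P.isOpen_K hφ hcompact hsub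
  rw [normalTrace_add P.isBounded_K hw hg hφ₁.1 hφ₂, hinterface φ₁ hφ₁, houter φ₂ hφ₂ hdisj,
    add_zero]

theorem normalTrace_Km_eq_zero_and_Kf_eq_zero (hw : MemLp w 2 (volume.restrict P.K))
    (hg : MemLp g 2 (volume.restrict P.K))
    (h : ∀ φ : Plane → ℝ, ContDiff ℝ ∞ φ → normalTrace P.K w g φ = 0) (hφ : ContDiff ℝ ∞ φ)
    (hdisj : Disjoint (tsupport φ) (closure P.interface)) :
    normalTrace P.Km w g φ = 0 ∧ normalTrace P.Kf w g φ = 0 := by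
  obtain ⟨ψ, hψ, hψm, hψf⟩ := exists_contDiff_eqOn_eqOn_zero hφ
    (hdisj.mono_right P.closure_Km_inter_closure_Kf_subset)
  have hzero : normalTrace P.Kf w g ψ = 0 := by
    rw [normalTrace_congr P.isOpen_Kf hψf]
    simp [normalTrace]
  have hKm : normalTrace P.Km w g φ = 0 := by
    rw [← normalTrace_congr P.isOpen_Km hψm, ← h ψ hψ, P.normalTrace_K hw hg hψ, hzero, add_zero]
  refine ⟨hKm, ?_⟩
  rw [← h φ hφ, P.normalTrace_K hw hg hφ, hKm, zero_add]

end Gluing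

section DarcyFlux

theorem darcyFlux_fun_sub (G G' : Plane → Plane) :
    P.darcyFlux (fun x => G x - G' x) = fun x => P.darcyFlux G x - P.darcyFlux G' x := by
  ext1 x
  simp only [darcyFlux, map_sub, smul_sub]
  abel

theorem exists_norm_darcyFlux_le :
    ∃ C : NNReal, ∀ (G : Plane → Plane), ∀ x ∈ P.K, ‖P.darcyFlux G x‖ ≤ C * ‖G x‖ := by
  obtain ⟨β, hβ⟩ := P.perm_bounded
  refine ⟨‖P.visc⁻¹‖₊ * β.toNNReal, fun G x hx => ?_⟩
  rw [darcyFlux, norm_neg, norm_smul, NNReal.coe_mul, coe_nnnorm, mul_assoc]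
  gcongr
  exact (P.perm x).le_of_opNorm_le ((hβ x hx).trans (Real.le_coe_toNNReal β)) _

theorem exists_eLpNorm_darcyFlux_le (p : ℝ≥0∞) :
    ∃ C : NNReal, ∀ (G : Plane → Plane), eLpNorm (P.darcyFlux G) p (volume.restrict P.K)
      ≤ C * eLpNorm G p (volume.restrict P.K) := by
  obtain ⟨C, hC⟩ := P.exists_norm_darcyFlux_le
  exact ⟨C, fun G => by
    simpa using eLpNorm_le_mul_eLpNorm_of_ae_le_mul
      ((ae_restrict_mem P.isOpen_K.measurableSet).mono (hC G)) p⟩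

theorem aestronglyMeasurable_darcyFlux {μ : Measure Plane} {G : Plane → Plane}
    (hG : AEStronglyMeasurable G μ) : AEStronglyMeasurable (P.darcyFlux G) μ := by
  let e := EuclideanSpace.basisFun (Fin 2) ℝ
  have hsum : P.darcyFlux G = fun x => -(P.visc⁻¹ • ∑ i, G x i • P.perm x (e i)) := by
    ext1 x
    rw [darcyFlux]
    conv_lhs => rw [← e.sum_repr (G x)]
    simp [e]
  rw [hsum]
  have hterm (i : Fin 2) : AEStronglyMeasurable (fun x => G x i • P.perm x (e i)) μ :=
    ((EuclideanSpace.proj (𝕜 := ℝ) i).continuous.comp_aestronglyMeasurable hG).smul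
      (P.perm_measurable _).aestronglyMeasurable
  exact ((Finset.aestronglyMeasurable_fun_sum _ fun i _ => hterm i).const_smul P.visc⁻¹).neg

theorem memLp_darcyFlux {p : ℝ≥0∞} {G : Plane → Plane} (hG : MemLp G p (volume.restrict P.K)) :
    MemLp (P.darcyFlux G) p (volume.restrict P.K) := by
  obtain ⟨C, hC⟩ := P.exists_eLpNorm_darcyFlux_le p
  exact ⟨P.aestronglyMeasurable_darcyFlux hG.1,
    (hC G).trans_lt (ENNReal.mul_lt_top ENNReal.coe_lt_top hG.2)⟩

theorem tendsto_eLpNorm_darcyFlux_sub {ι : Type*} {l : Filter ι} {p : ℝ≥0∞}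
    {G : ι → Plane → Plane} {G₀ : Plane → Plane}
    (h : Tendsto (fun i => eLpNorm (fun x => G i x - G₀ x) p (volume.restrict P.K)) l (𝓝 0)) :
    Tendsto (fun i => eLpNorm (fun x => P.darcyFlux (G i) x - P.darcyFlux G₀ x) p
      (volume.restrict P.K)) l (𝓝 0) := by
  obtain ⟨C, hC⟩ := P.exists_eLpNorm_darcyFlux_le p
  have hlim := ENNReal.Tendsto.const_mul h (.inr (ENNReal.coe_ne_top (r := C)))
  rw [mul_zero] at hlim
  refine tendsto_of_tendsto_of_tendsto_of_le_of_le tendsto_const_nhds hlim (fun _ => zero_le)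
    fun i => ?_
  rw [← P.darcyFlux_fun_sub]
  exact hC _

theorem exists_eLpNorm_sq_le_integral_inner_darcyFlux :
    ∃ C : NNReal, ∀ G : Plane → Plane, MemLp G 2 (volume.restrict P.K) →
      eLpNorm G 2 (volume.restrict P.K) ^ 2
        ≤ C * ‖∫ x in P.K, inner ℝ (P.darcyFlux G x) (G x)‖ₑ := by
  obtain ⟨α, hα, helliptic⟩ := P.perm_elliptic
  refine ⟨‖α⁻¹ * P.visc‖₊, fun G hG => ?_⟩
  have hsq := (memLp_two_iff_integrable_sq_norm hG.1).1 hG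
  have hflux : IntegrableOn (fun x => -inner ℝ (P.darcyFlux G x) (G x)) P.K :=
    (integrable_bilin (innerSL ℝ) (P.memLp_darcyFlux hG) hG).neg
  have hpointwise : ∀ x ∈ P.K, ‖G x‖ ^ 2
      ≤ α⁻¹ * P.visc * -inner ℝ (P.darcyFlux G x) (G x) := fun x hx => by
    have hvisc := P.visc_pos
    rw [darcyFlux, inner_neg_left, neg_neg, real_inner_smul_left, mul_assoc,
      mul_inv_cancel_left₀ hvisc.ne', inv_mul_eq_div, le_div_iff₀' hα]
    exact helliptic x hx (G x)
  have hle := setIntegral_mono_on hsq (hflux.const_mul _) P.isOpen_K.measurableSet hpointwise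
  have hnorm : eLpNorm G 2 (volume.restrict P.K) ^ 2 = ‖∫ x in P.K, ‖G x‖ ^ 2‖ₑ := by
    rw [Real.enorm_of_nonneg (by positivity),
      ofReal_integral_eq_lintegral_ofReal hsq (.of_forall fun x => by positivity)]
    simpa [ENNReal.ofReal_pow] using
      eLpNorm_nnreal_pow_eq_lintegral (f := G) (μ := volume.restrict P.K) (two_ne_zero' NNReal)
  calc eLpNorm G 2 (volume.restrict P.K) ^ 2 = ‖∫ x in P.K, ‖G x‖ ^ 2‖ₑ := hnorm
    _ ≤ ‖∫ x in P.K, α⁻¹ * P.visc * -inner ℝ (P.darcyFlux G x) (G x)‖ₑ := by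
        rw [enorm_le_iff_norm_le, Real.norm_of_nonneg (by positivity)]
        exact hle.trans (Real.le_norm_self _)
    _ = _ := by
        rw [integral_const_mul, integral_neg, enorm_mul, enorm_neg, enorm_eq_nnnorm]

end DarcyFlux

section Fluctuation

variable {P} {u v : Plane → ℝ}

theorem setAverage_fluctuation {D : Set Plane} (hD : D ⊆ P.K) [NeZero (volume.restrict D)]
    (hu : Integrable u (volume.restrict P.K)) :
    ⨍ x in D, P.fluctuation u x = (⨍ x in D, u x) - ⨍ x in P.K, u x := by
  have := P.isFiniteMeasure_restrict hD
  have hconst := average_const (volume.restrict D) (⨍ x in P.K, u x)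
  simp only [fluctuation, average_eq] at hconst ⊢
  rw [integral_sub (hu.mono_measure (Measure.restrict_mono hD le_rfl)) (integrable_const _),
    smul_sub, hconst]

theorem average_fluctuation (hu : Integrable u (volume.restrict P.K)) :
    ⨍ x in P.K, P.fluctuation u x = 0 :=
  (setAverage_fluctuation le_rfl hu).trans (sub_self _)

theorem fluctuation_sub (hu : Integrable u (volume.restrict P.K))
    (hv : Integrable v (volume.restrict P.K)) :
    P.fluctuation (fun x => u x - v x) = fun x => P.fluctuation u x - P.fluctuation v x := by
  ext1 x
  simp only [fluctuation, setAverage_eq]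
  rw [integral_sub hu hv, smul_sub]
  ring

theorem fluctuation_of_average_eq_zero (h : ⨍ x in P.K, u x = 0) : P.fluctuation u = u := by
  ext1 x
  rw [fluctuation, h, sub_zero]

theorem hasH1Gradient_fluctuation_iff {G : Plane → Plane} :
    HasH1Gradient P.K (P.fluctuation u) G ↔ HasH1Gradient P.K u G := by
  have hshift {v : Plane → ℝ} (c : ℝ) (h : HasH1Gradient P.K v G) :
      HasH1Gradient P.K (fun x => v x - c) G :=
    (h.sub (HasH1Gradient.const P.isBounded_K c)).congr_ae .rfl (.of_forall fun _ => sub_zero _)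
  refine ⟨fun h => (hshift (-⨍ x in P.K, u x) h).congr_ae (.of_forall fun x => ?_) .rfl, hshift _⟩
  simp [fluctuation]

end Fluctuation


section NeumannProblem

/-- The Neumann problem on the whole cell: `u ∈ H¹(K)` has gradient `G`, its Darcy flux has
divergence `g`, and there is no flow through `∂K`. Both the equation and the boundary condition are
encoded by testing with all smooth functions. -/
structure IsNeumannSolution (P : MFProblem) (u : Plane → ℝ) (G : Plane → Plane)
    (g : Plane → ℝ) : Prop where
  hasH1Gradient : HasH1Gradient P.K u G
  memLp_source : MemLp g 2 (volume.restrict P.K)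
  normalTrace_eq_zero : ∀ φ : Plane → ℝ, ContDiff ℝ ∞ φ →
    normalTrace P.K (P.darcyFlux G) g φ = 0

variable {P : MFProblem} {u u' g g' : Plane → ℝ} {G G' : Plane → Plane}

namespace IsNeumannSolution

theorem memLp (h : P.IsNeumannSolution u G g) : MemLp u 2 (volume.restrict P.K) :=
  h.hasH1Gradient.memLp

theorem integrable (h : P.IsNeumannSolution u G g) : Integrable u (volume.restrict P.K) :=
  h.memLp.integrable one_le_two

theorem memLp_gradient (h : P.IsNeumannSolution u G g) : MemLp G 2 (volume.restrict P.K) :=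
  h.hasH1Gradient.memLp_gradient

theorem memLp_flux (h : P.IsNeumannSolution u G g) :
    MemLp (P.darcyFlux G) 2 (volume.restrict P.K) :=
  P.memLp_darcyFlux h.memLp_gradient

theorem hasWeakDivergence (h : P.IsNeumannSolution u G g) :
    HasWeakDivergence P.K (P.darcyFlux G) g :=
  hasWeakDivergence_iff.2 ⟨h.memLp_flux, h.memLp_source, fun φ hφ => h.normalTrace_eq_zero φ hφ.1⟩

theorem congr_source (h : P.IsNeumannSolution u G g) (hg : g =ᵐ[volume.restrict P.K] g') :
    P.IsNeumannSolution u G g' :=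
  ⟨h.hasH1Gradient, h.memLp_source.ae_eq hg, fun φ hφ =>
    (normalTrace_congr_ae .rfl hg).symm.trans (h.normalTrace_eq_zero φ hφ)⟩

theorem sub (h : P.IsNeumannSolution u G g) (h' : P.IsNeumannSolution u' G' g') :
    P.IsNeumannSolution (fun x => u x - u' x) (fun x => G x - G' x) (fun x => g x - g' x) := by
  refine ⟨h.hasH1Gradient.sub h'.hasH1Gradient, h.memLp_source.sub h'.memLp_source,
    fun φ hφ => ?_⟩
  rw [P.darcyFlux_fun_sub, normalTrace_fun_sub h.memLp_flux h.memLp_source h'.memLp_flux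
    h'.memLp_source (memLp_restrict_of_continuous hφ.continuous P.isBounded_K 2)
    (memLp_gradient_restrict hφ P.isBounded_K 2), h.normalTrace_eq_zero φ hφ,
    h'.normalTrace_eq_zero φ hφ, sub_zero]

end IsNeumannSolution

theorem isNeumannSolution_fluctuation_iff :
    P.IsNeumannSolution (P.fluctuation u) G g ↔ P.IsNeumannSolution u G g :=
  ⟨fun h => ⟨hasH1Gradient_fluctuation_iff.1 h.1, h.2, h.3⟩,
    fun h => ⟨hasH1Gradient_fluctuation_iff.2 h.1, h.2, h.3⟩⟩

namespace IsNeumannSolution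

theorem integral_inner_darcyFlux (h : P.IsNeumannSolution u G g) :
    ∫ x in P.K, inner ℝ (P.darcyFlux G x) (G x) = -∫ x in P.K, g x * u x :=
  eq_neg_of_add_eq_zero_left (h.hasH1Gradient.integral_inner_add_eq_zero P.isOpen_K P.isBounded_K
    P.convex_K P.K_nonempty h.memLp_flux h.memLp_source h.normalTrace_eq_zero)

end IsNeumannSolution

variable (P)

theorem exists_eLpNorm_fluctuation_le : ∃ C : NNReal, ∀ u G, HasH1Gradient P.K u G →
    eLpNorm (P.fluctuation u) 2 (volume.restrict P.K) ≤ C * eLpNorm G 2 (volume.restrict P.K) := by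
  refine ⟨2 * (Metric.ediam P.K).toNNReal, fun u G h => ?_⟩
  rw [ENNReal.coe_mul, ENNReal.coe_toNNReal P.isBounded_K.ediam_ne_top]
  exact h.poincare P.isOpen_K P.isBounded_K P.convex_K P.K_nonempty

theorem exists_eLpNorm_gradient_le : ∃ C : NNReal, ∀ u G g, P.IsNeumannSolution u G g →
    eLpNorm G 2 (volume.restrict P.K) ≤ C * eLpNorm g 2 (volume.restrict P.K) := by
  obtain ⟨C₁, hC₁⟩ := P.exists_eLpNorm_sq_le_integral_inner_darcyFlux
  obtain ⟨C₂, hC₂⟩ := P.exists_eLpNorm_fluctuation_le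
  refine ⟨C₁ * C₂, fun u G g h => ?_⟩
  have h₀ := isNeumannSolution_fluctuation_iff.2 h
  have hpair : ‖∫ x in P.K, g x * P.fluctuation u x‖ₑ ≤
      eLpNorm g 2 (volume.restrict P.K) * eLpNorm (P.fluctuation u) 2 (volume.restrict P.K) := by
    have hmul : ‖ContinuousLinearMap.mul ℝ ℝ‖ₑ = 1 := by
      rw [← ofReal_norm, ContinuousLinearMap.opNorm_mul, ENNReal.ofReal_one]
    simpa [hmul] using enorm_integral_bilin_le (p := 2) (q := 2) (ContinuousLinearMap.mul ℝ ℝ)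
      h₀.memLp_source.1 h₀.memLp.1
  have hsq : eLpNorm G 2 (volume.restrict P.K) * eLpNorm G 2 (volume.restrict P.K)
      ≤ ↑(C₁ * C₂) * eLpNorm g 2 (volume.restrict P.K) * eLpNorm G 2 (volume.restrict P.K) :=
    calc eLpNorm G 2 (volume.restrict P.K) * eLpNorm G 2 (volume.restrict P.K)
        ≤ C₁ * ‖∫ x in P.K, g x * P.fluctuation u x‖ₑ := by
          rw [← sq, ← enorm_neg, ← h₀.integral_inner_darcyFlux]
          exact hC₁ G h.memLp_gradient
      _ ≤ C₁ * (eLpNorm g 2 (volume.restrict P.K)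
            * (C₂ * eLpNorm G 2 (volume.restrict P.K))) := by
          gcongr
          exact hpair.trans (by gcongr; exact hC₂ u G h.hasH1Gradient)
      _ = _ := by rw [ENNReal.coe_mul]; ring
  rcases eq_or_ne (eLpNorm G 2 (volume.restrict P.K)) 0 with hzero | hzero
  · simp [hzero]
  · exact (ENNReal.mul_le_mul_iff_left hzero h.memLp_gradient.2.ne).1 hsq

variable {P}

namespace IsNeumannSolution

variable {ι : Type*} {l : Filter ι} {u : ι → Plane → ℝ} {G : ι → Plane → Plane}
  {g : ι → Plane → ℝ} {u₀ g₀ : Plane → ℝ} {G₀ : Plane → Plane}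

theorem of_tendsto [l.NeBot] (h : ∀ᶠ i in l, P.IsNeumannSolution (u i) (G i) (g i))
    (hu₀ : MemLp u₀ 2 (volume.restrict P.K)) (hG₀ : MemLp G₀ 2 (volume.restrict P.K))
    (hg₀ : MemLp g₀ 2 (volume.restrict P.K))
    (hu : Tendsto (fun i => eLpNorm (fun x => u i x - u₀ x) 2 (volume.restrict P.K)) l (𝓝 0))
    (hG : Tendsto (fun i => eLpNorm (fun x => G i x - G₀ x) 2 (volume.restrict P.K)) l (𝓝 0))
    (hg : Tendsto (fun i => eLpNorm (fun x => g i x - g₀ x) 2 (volume.restrict P.K)) l (𝓝 0)) :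
    P.IsNeumannSolution u₀ G₀ g₀ := by
  refine ⟨.of_tendsto (h.mono fun i hi => hi.hasH1Gradient) hu₀ hG₀ hu hG, hg₀, fun φ hφ => ?_⟩
  have hlim := tendsto_normalTrace (h.mono fun i hi => hi.memLp_flux)
    (h.mono fun i hi => hi.memLp_source) (P.memLp_darcyFlux hG₀) hg₀
    (P.tendsto_eLpNorm_darcyFlux_sub hG) hg
    (memLp_restrict_of_continuous hφ.continuous P.isBounded_K 2)
    (memLp_gradient_restrict hφ P.isBounded_K 2)
  exact tendsto_nhds_unique hlim
    (tendsto_const_nhds.congr' (h.mono fun i hi => (hi.normalTrace_eq_zero φ hφ).symm))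

theorem tendsto_eLpNorm_gradient_sub_prod
    (h : ∀ᶠ i in l, P.IsNeumannSolution (u i) (G i) (g i))
    (hg₀ : MemLp g₀ 2 (volume.restrict P.K))
    (hg : Tendsto (fun i => eLpNorm (fun x => g i x - g₀ x) 2 (volume.restrict P.K)) l (𝓝 0)) :
    Tendsto (fun ij : ι × ι => eLpNorm (fun x => G ij.1 x - G ij.2 x) 2 (volume.restrict P.K))
      (l ×ˢ l) (𝓝 0) := by
  obtain ⟨C, hC⟩ := P.exists_eLpNorm_gradient_le
  have hbound := ENNReal.Tendsto.const_mul (tendsto_eLpNorm_sub_prod one_le_two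
    (h.mono fun i hi => hi.memLp_source) hg₀ hg) (.inr (ENNReal.coe_ne_top (r := C)))
  rw [mul_zero] at hbound
  refine tendsto_of_tendsto_of_tendsto_of_le_of_le' tendsto_const_nhds hbound
    (.of_forall fun _ => zero_le) ?_
  filter_upwards [h.prod_mk h] with ij hij
  exact hC _ _ _ (hij.1.sub hij.2)

theorem tendsto_eLpNorm_fluctuation_sub_prod
    (h : ∀ᶠ i in l, P.IsNeumannSolution (u i) (G i) (g i))
    (hg₀ : MemLp g₀ 2 (volume.restrict P.K))
    (hg : Tendsto (fun i => eLpNorm (fun x => g i x - g₀ x) 2 (volume.restrict P.K)) l (𝓝 0)) :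
    Tendsto (fun ij : ι × ι => eLpNorm (fun x => P.fluctuation (u ij.1) x
      - P.fluctuation (u ij.2) x) 2 (volume.restrict P.K)) (l ×ˢ l) (𝓝 0) := by
  obtain ⟨C, hC⟩ := P.exists_eLpNorm_fluctuation_le
  have hbound := ENNReal.Tendsto.const_mul (tendsto_eLpNorm_gradient_sub_prod h hg₀ hg)
    (.inr (ENNReal.coe_ne_top (r := C)))
  rw [mul_zero] at hbound
  refine tendsto_of_tendsto_of_tendsto_of_le_of_le' tendsto_const_nhds hbound
    (.of_forall fun _ => zero_le) ?_
  filter_upwards [h.prod_mk h] with ij hij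
  rw [← fluctuation_sub hij.1.integrable hij.2.integrable]
  exact hC _ _ (hij.1.sub hij.2).hasH1Gradient

theorem exists_tendsto [l.NeBot] (h : ∀ᶠ i in l, P.IsNeumannSolution (u i) (G i) (g i))
    (hg₀ : MemLp g₀ 2 (volume.restrict P.K))
    (hg : Tendsto (fun i => eLpNorm (fun x => g i x - g₀ x) 2 (volume.restrict P.K)) l (𝓝 0)) :
    ∃ w Gw, P.IsNeumannSolution w Gw g₀ ∧ ⨍ x in P.K, w x = 0 ∧
      Tendsto (fun i => eLpNorm (fun x => P.fluctuation (u i) x - w x) 2 (volume.restrict P.K))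
        l (𝓝 0) ∧
      Tendsto (fun i => eLpNorm (fun x => G i x - Gw x) 2 (volume.restrict P.K)) l (𝓝 0) := by
  have hfluct := h.mono fun i hi => isNeumannSolution_fluctuation_iff.2 hi
  have hmem := hfluct.mono fun i hi => hi.memLp
  obtain ⟨w, hw, hwlim⟩ := exists_tendsto_eLpNorm_sub one_le_two hmem
    (tendsto_eLpNorm_fluctuation_sub_prod h hg₀ hg)
  obtain ⟨Gw, hGw, hGlim⟩ := exists_tendsto_eLpNorm_sub one_le_two
    (h.mono fun i hi => hi.memLp_gradient) (tendsto_eLpNorm_gradient_sub_prod h hg₀ hg)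
  refine ⟨w, Gw, .of_tendsto hfluct hw hGw hg₀ hwlim hGlim hg, ?_, hwlim, hGlim⟩
  exact tendsto_nhds_unique (tendsto_average_of_tendsto_eLpNorm one_le_two hmem hw hwlim)
    (tendsto_const_nhds.congr' (h.mono fun i hi => (average_fluctuation hi.integrable).symm))

theorem fluctuation_ae_eq {u u' g : Plane → ℝ} {G G' : Plane → Plane}
    (h : P.IsNeumannSolution u G g) (h' : P.IsNeumannSolution u' G' g) :
    P.fluctuation u =ᵐ[volume.restrict P.K] P.fluctuation u' := by
  obtain ⟨C₁, hC₁⟩ := P.exists_eLpNorm_fluctuation_le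
  obtain ⟨C₂, hC₂⟩ := P.exists_eLpNorm_gradient_le
  have hgrad : eLpNorm (fun x => G x - G' x) 2 (volume.restrict P.K) = 0 := by
    simpa using hC₂ _ _ _ (h.sub h')
  have hzero := hC₁ _ _ (h.sub h').hasH1Gradient
  rw [hgrad, mul_zero, nonpos_iff_eq_zero, fluctuation_sub h.integrable h'.integrable] at hzero
  exact ((eLpNorm_eq_zero_iff ((isNeumannSolution_fluctuation_iff.2 h).memLp.1.sub
    (isNeumannSolution_fluctuation_iff.2 h').memLp.1) two_ne_zero).1 hzero).mono
    fun x hx => sub_eq_zero.1 hx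

end IsNeumannSolution

end NeumannProblem

section Sources

variable (P : MFProblem) (s : Plane → ℝ) (qs : ℝ) {x : Plane}

/-- The divergence of the flux that the flow equations prescribe when `s` is the time derivative of
the pressure. -/
noncomputable def fluxDivergence : Plane → ℝ := fun x =>
  P.Kf.indicator (fun y => P.q - P.cf * P.Φf * s y) x
    + P.Km.indicator (fun y => -(P.cm * P.Φm * s y)) x

theorem fluxDivergence_of_mem_Km (hx : x ∈ P.Km) :
    P.fluxDivergence s x = -(P.cm * P.Φm * s x) := by
  simp [fluxDivergence, hx, disjoint_left.1 P.disjoint_Km_Kf hx]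

theorem fluxDivergence_of_mem_Kf (hx : x ∈ P.Kf) :
    P.fluxDivergence s x = P.q - P.cf * P.Φf * s x := by
  simp [fluxDivergence, hx, disjoint_right.1 P.disjoint_Km_Kf hx]

theorem stationarySource_of_mem_Km (hx : x ∈ P.Km) :
    P.stationarySource qs x = -(volume.real P.Kf / volume.real P.Km) * qs := by
  simp [stationarySource, hx, disjoint_left.1 P.disjoint_Km_Kf hx]

theorem stationarySource_of_mem_Kf (hx : x ∈ P.Kf) : P.stationarySource qs x = qs := by
  simp [stationarySource, hx, disjoint_right.1 P.disjoint_Km_Kf hx]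

theorem memLp_stationarySource : MemLp (P.stationarySource qs) 2 (volume.restrict P.K) :=
  ((memLp_const qs).indicator P.isOpen_Kf.measurableSet).add
    ((memLp_const _).indicator P.isOpen_Km.measurableSet)

variable {P s} {p g : Plane → ℝ} {am af : ℝ}

theorem ae_eq_fluxDivergence_iff : g =ᵐ[volume.restrict P.K] P.fluxDivergence s ↔
    (∀ᵐ x ∂volume.restrict P.Km, P.cm * P.Φm * s x + g x = 0) ∧
      ∀ᵐ x ∂volume.restrict P.Kf, P.cf * P.Φf * s x + g x = P.q := by
  refine P.ae_restrict_K_iff.trans (and_congr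
    (eventually_congr ?_) (eventually_congr ?_))
  · filter_upwards [ae_restrict_mem P.isOpen_Km.measurableSet] with x hx
    rw [P.fluxDivergence_of_mem_Km s hx, ← eq_neg_iff_add_eq_zero, eq_neg_iff_add_eq_zero,
      add_comm, ← eq_neg_iff_add_eq_zero]
  · filter_upwards [ae_restrict_mem P.isOpen_Kf.measurableSet] with x hx
    rw [P.fluxDivergence_of_mem_Kf s hx, eq_sub_iff_add_eq']

theorem Balance.stationarySource_of_mem_Km (h : P.Balance am af) (hx : x ∈ P.Km) :
    P.stationarySource (P.q - P.cf * P.Φf * af) x = -(P.cm * P.Φm * am) := by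
  have hV := P.volume_real_Km_pos
  rw [P.stationarySource_of_mem_Km _ hx]
  unfold Balance at h
  field_simp
  linarith

theorem Balance.fluxDivergence_ae_eq (h : P.Balance am af)
    (hm : ∀ᵐ x ∂volume.restrict P.Km, s x = am) (hf : ∀ᵐ x ∂volume.restrict P.Kf, s x = af) :
    P.fluxDivergence s =ᵐ[volume.restrict P.K] P.stationarySource (P.q - P.cf * P.Φf * af) := by
  refine P.ae_restrict_K_iff.2 ⟨?_, ?_⟩
  · filter_upwards [hm, ae_restrict_mem P.isOpen_Km.measurableSet] with x hx hxm
    rw [P.fluxDivergence_of_mem_Km s hxm, h.stationarySource_of_mem_Km hxm, hx]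
  · filter_upwards [hf, ae_restrict_mem P.isOpen_Kf.measurableSet] with x hx hxf
    rw [P.fluxDivergence_of_mem_Kf s hxf, P.stationarySource_of_mem_Kf _ hxf, hx]

theorem Balance.tendsto_fluxDivergence {s : ℝ → Plane → ℝ} (h : P.Balance am af)
    (hs : P.TendsToPseudoSteady s am af) :
    Tendsto (fun t => eLpNorm (fun x => P.fluxDivergence (s t) x
      - P.stationarySource (P.q - P.cf * P.Φf * af) x) 2 (volume.restrict P.K)) atTop (𝓝 0) := by
  have hlim : Tendsto (fun t =>
      ‖-(P.cm * P.Φm)‖ₑ * eLpNorm (fun x => s t x - am) 2 (volume.restrict P.Km)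
        + ‖-(P.cf * P.Φf)‖ₑ * eLpNorm (fun x => s t x - af) 2 (volume.restrict P.Kf))
      atTop (𝓝 0) := by
    simpa using
      (ENNReal.Tendsto.const_mul (a := ‖-(P.cm * P.Φm)‖ₑ) hs.1 (.inr enorm_ne_top)).add
        (ENNReal.Tendsto.const_mul (a := ‖-(P.cf * P.Φf)‖ₑ) hs.2 (.inr enorm_ne_top))
  refine tendsto_of_tendsto_of_tendsto_of_le_of_le tendsto_const_nhds hlim (fun _ => zero_le)
    fun t => ?_
  rw [P.restrict_K, ← eLpNorm_const_smul, ← eLpNorm_const_smul]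
  refine (eLpNorm_add_measure_le one_le_two _).trans
    (add_le_add (eLpNorm_congr_ae ?_).le (eLpNorm_congr_ae ?_).le)
  · filter_upwards [ae_restrict_mem P.isOpen_Km.measurableSet] with x hx
    rw [P.fluxDivergence_of_mem_Km _ hx, h.stationarySource_of_mem_Km hx, Pi.smul_apply,
      smul_eq_mul]
    ring
  · filter_upwards [ae_restrict_mem P.isOpen_Kf.measurableSet] with x hx
    rw [P.fluxDivergence_of_mem_Kf _ hx, P.stationarySource_of_mem_Kf _ hx, Pi.smul_apply,
      smul_eq_mul]
    ring

end Sources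

section FlowProblem

variable {P : MFProblem} {p s : Plane → ℝ} {qs am af : ℝ}

theorem HoldsAt.exists_isNeumannSolution (h : P.HoldsAt p s) :
    ∃ G, P.IsNeumannSolution p G (P.fluxDivergence s) := by
  obtain ⟨G, g, hm, hf, hdivm, heqm, hdivf, heqf, houter, hpressure, hflux⟩ := h
  have hH1 := P.hasH1Gradient_K_iff.2 ⟨hm, hf, hpressure⟩
  have hg := P.memLp_restrict_K one_le_two hdivm.memLp_div hdivf.memLp_div
  have hw := P.memLp_darcyFlux hH1.memLp_gradient
  have hsol : P.IsNeumannSolution p G g := by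
    refine ⟨hH1, hg, fun φ hφ => P.normalTrace_K_eq_zero hw hg (fun φ hφ => ?_)
      (fun φ hφ hdisj => ?_) hφ⟩
    · rw [P.normalTrace_K hw hg hφ.1, hflux φ hφ]
    · rw [P.normalTrace_K hw hg hφ, (houter φ hφ hdisj).1, (houter φ hφ hdisj).2, add_zero]
  exact ⟨G, hsol.congr_source (ae_eq_fluxDivergence_iff.2 ⟨heqm, heqf⟩)⟩

theorem IsNeumannSolution.holdsAt {G : Plane → Plane}
    (h : P.IsNeumannSolution p G (P.fluxDivergence s)) : P.HoldsAt p s := by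
  obtain ⟨hm, hf, hpressure⟩ := P.hasH1Gradient_K_iff.1 h.hasH1Gradient
  obtain ⟨heqm, heqf⟩ := ae_eq_fluxDivergence_iff.1 (ae_eq_refl (P.fluxDivergence s))
  refine ⟨G, P.fluxDivergence s, hm, hf, h.hasWeakDivergence.mono P.Km_subset, heqm,
    h.hasWeakDivergence.mono P.Kf_subset, heqf, fun φ => ?_, hpressure, fun φ hφ => ?_⟩
  · exact P.normalTrace_Km_eq_zero_and_Kf_eq_zero h.memLp_flux h.memLp_source h.normalTrace_eq_zero
  · rw [← P.normalTrace_K h.memLp_flux h.memLp_source hφ.1, h.normalTrace_eq_zero φ hφ.1]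

theorem isStationarySolution_iff : P.IsStationarySolution qs p ↔
    (∃ G, P.IsNeumannSolution p G (P.stationarySource qs)) ∧ ⨍ x in P.K, p x = 0 :=
  and_congr_left fun _ => exists_congr fun _ =>
    ⟨fun ⟨hH1, hdiv, htrace⟩ => ⟨hH1, hdiv.memLp_div, htrace⟩,
      fun h => ⟨h.hasH1Gradient, h.hasWeakDivergence, h.normalTrace_eq_zero⟩⟩

theorem isStationarySolution_fluctuation_iff : P.IsStationarySolution qs (P.fluctuation p) ↔
    ∃ G, P.IsNeumannSolution p G (P.stationarySource qs) := by
  rw [isStationarySolution_iff]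
  simp only [isNeumannSolution_fluctuation_iff]
  exact and_iff_left_of_imp fun ⟨_, h⟩ => average_fluctuation h.integrable

theorem IsStationarySolution.ae_eq {p' : Plane → ℝ} (h : P.IsStationarySolution qs p)
    (h' : P.IsStationarySolution qs p') : p =ᵐ[volume.restrict P.K] p' := by
  obtain ⟨⟨G, hG⟩, hmean⟩ := isStationarySolution_iff.1 h
  obtain ⟨⟨G', hG'⟩, hmean'⟩ := isStationarySolution_iff.1 h'
  simpa only [fluctuation_of_average_eq_zero hmean, fluctuation_of_average_eq_zero hmean']
    using hG.fluctuation_ae_eq hG'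

theorem Balance.holdsAt_iff (h : P.Balance am af) (hm : ∀ᵐ x ∂volume.restrict P.Km, s x = am)
    (hf : ∀ᵐ x ∂volume.restrict P.Kf, s x = af) : P.HoldsAt p s ↔
      P.IsStationarySolution (P.q - P.cf * P.Φf * af) (P.fluctuation p) := by
  have hsource := h.fluxDivergence_ae_eq hm hf
  rw [isStationarySolution_fluctuation_iff]
  exact ⟨fun hp => hp.exists_isNeumannSolution.imp fun _ hG => hG.congr_source hsource,
    fun ⟨_, hG⟩ => (hG.congr_source hsource.symm).holdsAt⟩

theorem HoldsAt.mass_balance (h : P.HoldsAt p s) :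
    (∫ x in P.Km, P.cm * P.Φm * s x) + (∫ x in P.Kf, P.cf * P.Φf * s x) = ∫ _x in P.Kf, P.q := by
  obtain ⟨G, hG⟩ := h.exists_isNeumannSolution
  have hint : IntegrableOn (P.fluxDivergence s) P.K := hG.memLp_source.integrable one_le_two
  have htest := hG.normalTrace_eq_zero (fun _ => 1) contDiff_const
  simp only [normalTrace, gradient_fun_const, inner_zero_right, zero_add, mul_one] at htest
  have hm : ∫ x in P.Km, P.cm * P.Φm * s x = ∫ x in P.Km, -P.fluxDivergence s x :=
    setIntegral_congr_fun P.isOpen_Km.measurableSet fun x hx => by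
      rw [P.fluxDivergence_of_mem_Km s hx, neg_neg]
  have hf : ∫ x in P.Kf, P.cf * P.Φf * s x = ∫ x in P.Kf, (P.q - P.fluxDivergence s x) :=
    setIntegral_congr_fun P.isOpen_Kf.measurableSet fun x hx => by
      rw [P.fluxDivergence_of_mem_Kf s hx, sub_sub_cancel]
  rw [P.setIntegral_K hint] at htest
  rw [hm, hf, integral_neg, integral_sub (integrable_const _) (hint.mono_set P.Kf_subset)]
  linarith

end FlowProblem

end MFProblem

section TimeDerivative

theorem tendsto_const_add_nhdsNE_zero (t : ℝ) : Tendsto (fun τ => t + τ) (𝓝[≠] 0) (𝓝 t) :=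
  ((continuous_const_add t).tendsto' 0 t (add_zero t)).mono_left nhdsWithin_le_nhds

variable {D : Set Plane} {p : ℝ → Plane → ℝ} {s : Plane → ℝ} {t : ℝ}

theorem HasL2TimeDeriv.hasDerivAt_integral [IsFiniteMeasure (volume.restrict D)]
    (h : HasL2TimeDeriv D p s t) (hp : ∀ᶠ τ in 𝓝 t, MemLp (p τ) 2 (volume.restrict D)) :
    HasDerivAt (fun τ => ∫ x in D, p τ x) (∫ x in D, s x) t := by
  have hpt := hp.self_of_nhds
  have hev := (tendsto_const_add_nhdsNE_zero t).eventually hp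
  rw [hasDerivAt_iff_tendsto_slope_zero]
  refine (tendsto_integral_of_tendsto_eLpNorm one_le_two
    (hev.mono fun τ hτ => (hτ.sub hpt).const_mul τ⁻¹) h.1 h.2).congr' (hev.mono fun τ hτ => ?_)
  rw [integral_const_mul, integral_sub' (hτ.integrable one_le_two) (hpt.integrable one_le_two)]
  rfl

theorem HasL2TimeDeriv.hasDerivAt_average [IsFiniteMeasure (volume.restrict D)]
    (h : HasL2TimeDeriv D p s t) (hp : ∀ᶠ τ in 𝓝 t, MemLp (p τ) 2 (volume.restrict D)) :
    HasDerivAt (fun τ => ⨍ x in D, p τ x) (⨍ x in D, s x) t := by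
  simpa only [setAverage_eq] using (h.hasDerivAt_integral hp).fun_const_smul (volume.real D)⁻¹

theorem HasL2TimeDeriv.of_eventually_ae_eq (hs : MemLp s 2 (volume.restrict D))
    (h : ∀ᶠ τ in 𝓝 t, ∀ᵐ x ∂volume.restrict D, p τ x = p t x + (τ - t) * s x) :
    HasL2TimeDeriv D p s t := by
  refine ⟨hs, tendsto_const_nhds.congr' ?_⟩
  filter_upwards [(tendsto_const_add_nhdsNE_zero t).eventually h, self_mem_nhdsWithin]
    with τ hτ (hne : τ ≠ 0)
  refine (eLpNorm_sub_eq_zero_of_ae_eq (hτ.mono fun x hx => ?_) 2).symm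
  rw [hx, add_sub_cancel_left, add_sub_cancel_left, inv_mul_cancel_left₀ hne]

end TimeDerivative

namespace MFProblem

variable {P : MFProblem}

theorem hasL2TimeDeriv_K {p : ℝ → Plane → ℝ} {s : Plane → ℝ} {t : ℝ}
    (hm : HasL2TimeDeriv P.Km p s t) (hf : HasL2TimeDeriv P.Kf p s t) :
    HasL2TimeDeriv P.K p s t := by
  refine ⟨P.memLp_restrict_K one_le_two hm.1 hf.1, ?_⟩
  rw [P.restrict_K]
  exact tendsto_of_tendsto_of_tendsto_of_le_of_le tendsto_const_nhds
    (by simpa only [add_zero] using hm.2.add hf.2) (fun _ => zero_le)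
    fun _ => eLpNorm_add_measure_le one_le_two _

section LongTime

variable {T t am af : ℝ} {p s : ℝ → Plane → ℝ}

theorem TendsToPseudoSteady.of_forall_ae_eq
    (hm : ∀ t, T < t → ∀ᵐ x ∂volume.restrict P.Km, s t x = am)
    (hf : ∀ t, T < t → ∀ᵐ x ∂volume.restrict P.Kf, s t x = af) :
    P.TendsToPseudoSteady s am af :=
  ⟨tendsto_const_nhds.congr' ((eventually_gt_atTop T).mono fun t ht =>
      (eLpNorm_sub_eq_zero_of_ae_eq (hm t ht) 2).symm),
    tendsto_const_nhds.congr' ((eventually_gt_atTop T).mono fun t ht =>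
      (eLpNorm_sub_eq_zero_of_ae_eq (hf t ht) 2).symm)⟩

namespace IsSolutionAfter

theorem memLp (h : P.IsSolutionAfter T p s) (ht : T < t) :
    MemLp (p t) 2 (volume.restrict P.K) :=
  let ⟨_, hG⟩ := (h t ht).2.2.exists_isNeumannSolution
  hG.memLp

theorem eventually_memLp {D : Set Plane} (h : P.IsSolutionAfter T p s) (hD : D ⊆ P.K)
    (ht : T < t) : ∀ᶠ τ in 𝓝 t, MemLp (p τ) 2 (volume.restrict D) :=
  (lt_mem_nhds ht).mono fun _ hτ => (h.memLp hτ).mono_measure (Measure.restrict_mono hD le_rfl)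

theorem balance (h : P.IsSolutionAfter T p s) (hs : P.TendsToPseudoSteady s am af) :
    P.Balance am af := by
  have hT := eventually_gt_atTop T
  have hm := tendsto_integral_of_tendsto_eLpNorm one_le_two (hT.mono fun t ht => (h t ht).1.1)
    (memLp_const am) hs.1
  have hf := tendsto_integral_of_tendsto_eLpNorm one_le_two (hT.mono fun t ht => (h t ht).2.1.1)
    (memLp_const af) hs.2
  have hmass := tendsto_nhds_unique ((hm.const_mul (P.cm * P.Φm)).add (hf.const_mul (P.cf * P.Φf)))
    (tendsto_const_nhds.congr' (hT.mono fun t ht => by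
      simpa only [integral_const_mul] using (h t ht).2.2.mass_balance.symm))
  simp only [setIntegral_const, smul_eq_mul] at hmass
  unfold Balance
  linarith

theorem exists_limit (h : P.IsSolutionAfter T p s) (hs : P.TendsToPseudoSteady s am af) :
    ∃ (w : Plane → ℝ) (Gw : Plane → Plane) (G : ℝ → Plane → Plane),
      P.IsStationarySolution (P.q - P.cf * P.Φf * af) w ∧
      HasH1Gradient P.K w Gw ∧ (∀ t, T < t → HasH1Gradient P.K (p t) (G t)) ∧
      Tendsto (fun t => eLpNorm (fun x => P.fluctuation (p t) x - w x) 2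
        (volume.restrict P.K)) atTop (𝓝 0) ∧
      Tendsto (fun t => eLpNorm (fun x => G t x - Gw x) 2
        (volume.restrict P.K)) atTop (𝓝 0) := by
  choose! G hG using fun t (ht : T < t) => (h t ht).2.2.exists_isNeumannSolution
  obtain ⟨w, Gw, hw, hmean, hwlim, hGlim⟩ := IsNeumannSolution.exists_tendsto
    ((eventually_gt_atTop T).mono hG) (P.memLp_stationarySource _)
    ((h.balance hs).tendsto_fluxDivergence hs)
  exact ⟨w, Gw, G, isStationarySolution_iff.2 ⟨⟨Gw, hw⟩, hmean⟩, hw.hasH1Gradient,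
    fun t ht => (hG t ht).hasH1Gradient, hwlim, hGlim⟩

theorem exists_tendsto_average_Km_sub_average_Kf (h : P.IsSolutionAfter T p s)
    (hs : P.TendsToPseudoSteady s am af) :
    ∃ a, Tendsto (fun t => (⨍ x in P.Km, p t x) - ⨍ x in P.Kf, p t x) atTop (𝓝 a) := by
  obtain ⟨w, Gw, G, -, hw, hG, hwlim, -⟩ := h.exists_limit hs
  have hT := eventually_gt_atTop T
  have haverage : ∀ D ⊆ P.K, Tendsto (fun t => ⨍ x in D, P.fluctuation (p t) x) atTop
      (𝓝 (⨍ x in D, w x)) := fun D hD => by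
    have := P.isFiniteMeasure_restrict hD
    have hle : volume.restrict D ≤ volume.restrict P.K := Measure.restrict_mono hD le_rfl
    exact tendsto_average_of_tendsto_eLpNorm one_le_two
      (hT.mono fun t ht => (hasH1Gradient_fluctuation_iff.2 (hG t ht)).memLp.mono_measure hle)
      (hw.memLp.mono_measure hle) (tendsto_of_tendsto_of_tendsto_of_le_of_le tendsto_const_nhds
        hwlim (fun _ => zero_le) fun t => eLpNorm_mono_measure _ hle)
  refine ⟨_, ((haverage P.Km P.Km_subset).sub (haverage P.Kf P.Kf_subset)).congr'
    (hT.mono fun t ht => ?_)⟩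
  have hint := (h.memLp ht).integrable one_le_two
  simp only [setAverage_fluctuation P.Km_subset hint, setAverage_fluctuation P.Kf_subset hint,
    sub_sub_sub_cancel_right]

theorem rates_eq (h : P.IsSolutionAfter T p s) (hs : P.TendsToPseudoSteady s am af) :
    am = af := by
  have hT := eventually_gt_atTop T
  have hm := tendsto_average_of_tendsto_eLpNorm one_le_two (hT.mono fun t ht => (h t ht).1.1)
    (memLp_const am) hs.1
  have hf := tendsto_average_of_tendsto_eLpNorm one_le_two (hT.mono fun t ht => (h t ht).2.1.1)
    (memLp_const af) hs.2
  rw [average_const] at hm hf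
  obtain ⟨a, ha⟩ := h.exists_tendsto_average_Km_sub_average_Kf hs
  exact sub_eq_zero.1 (eq_zero_of_tendsto_of_tendsto_deriv (fun t ht =>
    ((h t ht).1.hasDerivAt_average (h.eventually_memLp P.Km_subset ht)).fun_sub
      ((h t ht).2.1.hasDerivAt_average (h.eventually_memLp P.Kf_subset ht))) ha (hm.sub hf))

theorem exists_average_eq {a : ℝ} (h : P.IsSolutionAfter T p s)
    (hs : ∀ t, T < t → ∀ᵐ x ∂volume.restrict P.K, s t x = a) :
    ∃ C, ∀ t, T < t → ⨍ x in P.K, p t x = a * t + C := by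
  refine exists_eq_mul_add_of_hasDerivAt fun t ht => ?_
  have hderiv := (hasL2TimeDeriv_K (h t ht).1 (h t ht).2.1).hasDerivAt_average
    (h.eventually_memLp le_rfl ht)
  rwa [average_congr (hs t ht), average_const] at hderiv

end IsSolutionAfter

theorem hasL2TimeDeriv_const_of_isStationarySolution {D : Set Plane} {qs a C : ℝ} (hD : D ⊆ P.K)
    (hstat : ∀ t, T < t → P.IsStationarySolution qs (P.fluctuation (p t)))
    (hC : ∀ t, T < t → ⨍ x in P.K, p t x = a * t + C) (ht : T < t) :
    HasL2TimeDeriv D p (fun _ => a) t := by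
  have := P.isFiniteMeasure_restrict hD
  refine .of_eventually_ae_eq (memLp_const a) ((lt_mem_nhds ht).mono fun τ hτ => ?_)
  filter_upwards [ae_mono (Measure.restrict_mono hD le_rfl) ((hstat τ hτ).ae_eq (hstat t ht))]
    with x hx
  simp only [fluctuation, hC τ hτ, hC t ht] at hx
  linarith

theorem Balance.isPseudoSteadyAfter {a C : ℝ} (hbal : P.Balance a a)
    (hstat : ∀ t, T < t → P.IsStationarySolution (P.q - P.cf * P.Φf * a) (P.fluctuation (p t)))
    (hC : ∀ t, T < t → ⨍ x in P.K, p t x = a * t + C) : P.IsPseudoSteadyAfter T p a a :=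
  ⟨fun _ _ => a, fun t ht =>
    ⟨hasL2TimeDeriv_const_of_isStationarySolution P.Km_subset hstat hC ht,
      hasL2TimeDeriv_const_of_isStationarySolution P.Kf_subset hstat hC ht,
      (hbal.holdsAt_iff (.of_forall fun _ => rfl) (.of_forall fun _ => rfl)).2 (hstat t ht)⟩,
    fun _ _ => ⟨.of_forall fun _ => rfl, .of_forall fun _ => rfl⟩⟩

theorem isPseudoSteadyAfter_iff : P.IsPseudoSteadyAfter T p am af ↔
    P.Balance am af ∧ am = af ∧
      (∀ t, T < t → P.IsStationarySolution (P.q - P.cf * P.Φf * af) (P.fluctuation (p t))) ∧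
      ∃ C : ℝ, ∀ t, T < t → ⨍ x in P.K, p t x = af * t + C := by
  constructor
  · rintro ⟨s, hsol, hs⟩
    have hlim : P.TendsToPseudoSteady s am af :=
      .of_forall_ae_eq (fun t ht => (hs t ht).1) (fun t ht => (hs t ht).2)
    have hbal := hsol.balance hlim
    obtain rfl := hsol.rates_eq hlim
    exact ⟨hbal, rfl, fun t ht => (hbal.holdsAt_iff (hs t ht).1 (hs t ht).2).1 (hsol t ht).2.2,
      hsol.exists_average_eq fun t ht => P.ae_restrict_K_iff.2 (hs t ht)⟩
  · rintro ⟨hbal, rfl, hstat, C, hC⟩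
    exact hbal.isPseudoSteadyAfter hstat hC

end LongTime

end MFProblem

theorem mainTheorem1_general (P : MFProblem) :
    (∀ (T : ℝ) (p s : ℝ → Plane → ℝ), P.IsSolutionAfter T p s → ∀ t, T < t →
      (∫ x in P.Km, P.cm * P.Φm * s t x) + (∫ x in P.Kf, P.cf * P.Φf * s t x)
        = ∫ _x in P.Kf, P.q) ∧
    (∀ (qs : ℝ) (u v : Plane → ℝ), P.IsStationarySolution qs u → P.IsStationarySolution qs v →
      u =ᵐ[volume.restrict P.K] v) ∧
    (∀ (T : ℝ) (p : ℝ → Plane → ℝ) (am af : ℝ),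
      P.IsPseudoSteadyAfter T p am af ↔
        P.Balance am af ∧ am = af ∧
        (∀ t, T < t →
          P.IsStationarySolution (P.q - P.cf * P.Φf * af) (P.fluctuation (p t))) ∧
        ∃ C : ℝ, ∀ t, T < t → ⨍ x in P.K, p t x = af * t + C) ∧
    (∀ (T : ℝ) (p s : ℝ → Plane → ℝ) (am af : ℝ),
      P.IsSolutionAfter T p s → P.TendsToPseudoSteady s am af →
        P.Balance am af ∧ am = af ∧
        ∃ (w : Plane → ℝ) (Gw : Plane → Plane) (G : ℝ → Plane → Plane),
          P.IsStationarySolution (P.q - P.cf * P.Φf * af) w ∧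
          HasH1Gradient P.K w Gw ∧ (∀ t, T < t → HasH1Gradient P.K (p t) (G t)) ∧
          Tendsto (fun t => eLpNorm (fun x => P.fluctuation (p t) x - w x) 2
            (volume.restrict P.K)) atTop (𝓝 0) ∧
          Tendsto (fun t => eLpNorm (fun x => G t x - Gw x) 2
            (volume.restrict P.K)) atTop (𝓝 0)) :=
  ⟨fun _ _ _ h t ht => (h t ht).2.2.mass_balance, fun _ _ _ hu hv => hu.ae_eq hv,
    fun _ _ _ _ => MFProblem.isPseudoSteadyAfter_iff,
    fun _ _ _ _ _ h hs => ⟨h.balance hs, h.rates_eq hs, h.exists_limit hs⟩⟩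

theorem mainTheorem1 (P : MFProblem) :
    -- mass balance of every solution, at every time
    (∀ (T : ℝ) (p s : ℝ → Plane → ℝ), P.IsSolutionAfter T p s → ∀ t, T < t →
      (∫ x in P.Km, P.cm * P.Φm * s t x) + (∫ x in P.Kf, P.cf * P.Φf * s t x)
        = ∫ _x in P.Kf, P.q) ∧
    -- the stationary problem with zero mean has at most one solution
    (∀ (qs : ℝ) (u v : Plane → ℝ), P.IsStationarySolution qs u → P.IsStationarySolution qs v →
      u =ᵐ[volume.restrict P.K] v) ∧
    -- exact pseudo steady state: the balance, and equivalence with the stationary problem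
    (∀ (T : ℝ) (p : ℝ → Plane → ℝ) (am af : ℝ),
      P.IsPseudoSteadyAfter T p am af ↔
        P.Balance am af ∧ am = af ∧
        (∀ t, T < t →
          P.IsStationarySolution (P.q - P.cf * P.Φf * af) (P.fluctuation (p t))) ∧
        ∃ C : ℝ, ∀ t, T < t → ⨍ x in P.K, p t x = af * t + C) ∧
    -- zero initial data: pseudo steady state as the limit of large times
    (∀ (p s : ℝ → Plane → ℝ) (am af : ℝ),
      P.IsInitialValueSolution p s → P.TendsToPseudoSteady s am af →
        P.Balance am af ∧ am = af ∧
        ∃ (w : Plane → ℝ) (Gw : Plane → Plane) (G : ℝ → Plane → Plane),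
          P.IsStationarySolution (P.q - P.cf * P.Φf * af) w ∧
          HasH1Gradient P.K w Gw ∧ (∀ t, 0 < t → HasH1Gradient P.K (p t) (G t)) ∧
          Tendsto (fun t => eLpNorm (fun x => P.fluctuation (p t) x - w x) 2
            (volume.restrict P.K)) atTop (𝓝 0) ∧
          Tendsto (fun t => eLpNorm (fun x => G t x - Gw x) 2
            (volume.restrict P.K)) atTop (𝓝 0)) := by
  obtain ⟨hmass, hunique, hsteady, hlimit⟩ := mainTheorem1_general P
  exact ⟨hmass, hunique, hsteady, fun p s am af h => hlimit 0 p s am af h.1⟩
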